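/- **Theorem 6.2 (Generalized Bishop–Gromov volume growth inequality).** Let $(M,d)$ be a complete separable metric space with a locally finite Borel measure $m$ (every point has a ball of finite measure), and let $K,N\in\mathbb R$ with $N\ge 1$. *Definitions.* Let $\mathfrak S_k(\theta)=\frac{\sin(\sqrt k\,\theta)}{\sqrt k\,\theta}$ if $k>0$, $\mathfrak S_k(\theta)=1$ if $k=0$, $\mathfrak S_k(\theta)=\frac{\sinh(\sqrt{-k}\,\theta)}{\sqrt{-k}\,\theta}$ if $k<0$ (with $\mathfrak S_k(0)=1$), and for $t\in[0,1]$, $\theta\ge 0$ let $\sigma^{(t)}_{K,N}(\theta)=\infty$ if $K\theta^2\ge N\pi^2$ and $\sigma^{(t)}_{K,N}(\theta)=t\,\mathfrak S_{K/N}(t\theta)/\mathfrak S_{K/N}(\theta)$ otherwise. Let $\mathcal P_\infty(M,d,m)$ be the set of $m$-absolutely continuous Borel probability measures on $M$ with bounded support, equipped with the $L_2$-Wasserstein distance $d_W$. A geodesic in it is a curve $\Gamma:[0,1]\to\mathcal P_\infty(M,d,m)$ with $d_W(\Gamma(s),\Gamma(t))=|s-t|\,d_W(\Gamma(0),\Gamma(1))$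 for all $s,t\in[0,1]$. For $\nu=\rho m$ let $S_N(\nu|m)=-\int\rho^{-1/N}\,d\nu=-\int_{\{\rho>0\}}\rho^{1-1/N}\,dm\in[-\infty,0]$. $(M,d,m)$ satisfies $\mathsf{CD}^*(K,N)$ if for all $\nu_0=\rho_0m,\ \nu_1=\rho_1m\in\mathcal P_\infty(M,d,m)$ there are a $d_W$-optimal coupling $q$ of $\nu_0,\nu_1$ and a geodesic $\Gamma$ in $\mathcal P_\infty(M,d,m)$ from $\nu_0$ to $\nu_1$ such that for all $t\in[0,1]$ and all $N'\ge N$ $$S_{N'}(\Gamma(t)|m)\le-\int_{M\times M}\Big[\sigma^{(1-t)}_{K,N'}(d(x_0,x_1))\,\rho_0(x_0)^{-1/N'}+\sigma^{(t)}_{K,N'}(d(x_0,x_1))\,\rho_1(x_1)^{-1/N'}\Big]\,dq(x_0,x_1).$$ For $x_0\in M$ and $r>0$ put $\bar B_r=\{y:d(x_0,y)\le r\}$, $B_r=\{y:d(x_0,y)<r\}$, $v(r)=m(\bar B_r)$ and $s(r)=\limsup_{\delta\downarrow0}\frac1\delta\,m(\bar B_{r+\delta}\setminus B_r)\in[0,\infty]$.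 *Claim.* Assume that $(M,d,m)$ satisfies $\mathsf{CD}^*(K,N)$. Then every bounded closed set contained in $\operatorname{supp}(m)$ is compact and has finite $m$-measure. Moreover: * If $K>0$, then for every $x_0\in\operatorname{supp}(m)$ and all $0<r<R\le\pi\sqrt{N/K}$, $$\sin\big(r\sqrt{K/N}\big)^N s(R)\le\sin\big(R\sqrt{K/N}\big)^N s(r)\qquad\text{and}\qquad\frac{v(r)}{v(R)}\ge\frac{\int_0^r\sin\big(t\sqrt{K/N}\big)^N\,dt}{\int_0^R\sin\big(t\sqrt{K/N}\big)^N\,dt}.$$ * If $K<0$, then for every $x_0\in\operatorname{supp}(m)$ and all $0<r<R$, $$\sinh\big(r\sqrt{-K/N}\big)^N s(R)\le\sinh\big(R\sqrt{-K/N}\big)^N s(r)\qquad\text{and}\qquad\frac{v(r)}{v(R)}\ge\frac{\int_0^r\sinh\big(t\sqrt{-K/N}\big)^N\,dt}{\int_0^R\sinh\big(t\sqrt{-K/N}\big)^N\,dt}.$$ Here products in $[0,\infty]$ use $0\cdot\infty=0$. The first inequality in each case is the comparison $\frac{s(r)}{s(R)}\ge\big(\frac{\sin(r\sqrt{K/N})}{\sin(R\sqrt{K/N})}\big)^N$,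 respectively its $\sinh$ analogue, with denominators cleared. -/

import Mathlib

open scoped ENNReal Topology

noncomputable section

namespace ReducedCD

/-- The function `𝔖_k(θ)`: `sin(√k θ)/(√k θ)` for `k > 0`, `1` for `k = 0` and
`sinh(√(-k) θ)/(√(-k) θ)` for `k < 0`, with its continuous value `1` at `θ = 0`. -/
def frakS (k θ : ℝ) : ℝ :=
  if k = 0 ∨ θ = 0 then 1
  else if 0 < k then Real.sin (√k * θ) / (√k * θ)
  else Real.sinh (√(-k) * θ) / (√(-k) * θ)

/-- The reduced volume distortion coefficient `σ^{(t)}_{K,N}(θ) ∈ [0, ∞]`, for `t ∈ [0,1]`, `θ ≥ 0`.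
In the second case the real number is nonnegative, so that nothing is truncated. -/
def sigma (K N t θ : ℝ) : ℝ≥0∞ :=
  if N * Real.pi ^ 2 ≤ K * θ ^ 2 then ∞
  else ENNReal.ofReal (t * (frakS (K / N) (t * θ) / frakS (K / N) θ))

variable {M : Type*} [MetricSpace M] [MeasurableSpace M]

/-- `q` is a coupling of `μ` and `ν`: a measure on the product with marginals `μ` and `ν`
(automatically a probability measure if `μ` is one). -/
def IsCoupling (q : MeasureTheory.Measure (M × M)) (μ ν : MeasureTheory.Measure M) : Prop :=
  q.map Prod.fst = μ ∧ q.map Prod.snd = ν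

/-- The quadratic transport cost `∫ d²(x,y) dq(x,y)`. -/
def cost (q : MeasureTheory.Measure (M × M)) : ℝ≥0∞ :=
  ∫⁻ p, edist p.1 p.2 ^ 2 ∂q

/-- The `L²`-Wasserstein distance. -/
def wasserstein (μ ν : MeasureTheory.Measure M) : ℝ≥0∞ :=
  ⨅ (q : MeasureTheory.Measure (M × M)) (_ : IsCoupling q μ ν), cost q ^ (1 / 2 : ℝ)

/-- `q` is an optimal coupling: a coupling attaining the Wasserstein distance. -/
def IsOptimalCoupling (q : MeasureTheory.Measure (M × M)) (μ ν : MeasureTheory.Measure M) : Prop :=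
  IsCoupling q μ ν ∧ cost q ^ (1 / 2 : ℝ) = wasserstein μ ν

/-- `ν` belongs to `𝒫_∞(M, d, m)`: it is an `m`-absolutely continuous Borel probability measure with
bounded support. -/
structure MemPInfty (m ν : MeasureTheory.Measure M) : Prop where
  isProbabilityMeasure : MeasureTheory.IsProbabilityMeasure ν
  absolutelyContinuous : ν.AbsolutelyContinuous m
  isBounded_support : Bornology.IsBounded ν.support

/-- `Γ : [0,1] → 𝒫_∞(M, d, m)` is a (constant speed) geodesic from `ν₀` to `ν₁` with respect to the
Wasserstein distance. Values of `Γ` outside `[0,1]` play no role. -/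
structure IsGeodesic (m : MeasureTheory.Measure M) (Γ : ℝ → MeasureTheory.Measure M)
    (ν₀ ν₁ : MeasureTheory.Measure M) : Prop where
  mem : ∀ t ∈ Set.Icc (0 : ℝ) 1, MemPInfty m (Γ t)
  zero : Γ 0 = ν₀
  one : Γ 1 = ν₁
  dist_eq : ∀ s ∈ Set.Icc (0 : ℝ) 1, ∀ t ∈ Set.Icc (0 : ℝ) 1,
    wasserstein (Γ s) (Γ t) = ENNReal.ofReal |s - t| * wasserstein ν₀ ν₁

/-- The Rényi entropy `S_N(ν|m) = -∫ ρ^{-1/N} dν ∈ [-∞, 0]` of `ν = ρ m`. Since `dν = ρ dm` this is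
`-∫_{ρ > 0} ρ^{1-1/N} dm`; for `N = 1` it is `-m(ρ > 0)`. -/
def renyiEntropy (N : ℝ) (ν m : MeasureTheory.Measure M) : EReal :=
  -((∫⁻ x, (ν.rnDeriv m x) ^ (-(1 / N)) ∂ν : ℝ≥0∞) : EReal)

/-- The reduced curvature-dimension condition `CD*(K, N)`, for real `K` and `N ≥ 1`. -/
def CDStar (K N : ℝ) (m : MeasureTheory.Measure M) : Prop :=
  ∀ ν₀ ν₁ : MeasureTheory.Measure M, MemPInfty m ν₀ → MemPInfty m ν₁ →
    ∃ (q : MeasureTheory.Measure (M × M)) (Γ : ℝ → MeasureTheory.Measure M),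
      IsOptimalCoupling q ν₀ ν₁ ∧ IsGeodesic m Γ ν₀ ν₁ ∧
      ∀ t ∈ Set.Icc (0 : ℝ) 1, ∀ N' : ℝ, N ≤ N' →
        renyiEntropy N' (Γ t) m ≤
          -((∫⁻ p, (sigma K N' (1 - t) (dist p.1 p.2) * (ν₀.rnDeriv m p.1) ^ (-(1 / N')) +
              sigma K N' t (dist p.1 p.2) * (ν₁.rnDeriv m p.2) ^ (-(1 / N'))) ∂q : ℝ≥0∞) : EReal)

/-- The volume `v(r)` of the closed ball of radius `r` around `x₀`. -/
def ballVolume (m : MeasureTheory.Measure M) (x₀ : M) (r : ℝ) : ℝ≥0∞ :=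
  m (Metric.closedBall x₀ r)

/-- The volume `s(r) = limsup_{δ → 0} (1/δ) m(closedBall (r+δ) \ ball r)` of the sphere of radius `r`
around `x₀`. -/
def sphereVolume (m : MeasureTheory.Measure M) (x₀ : M) (r : ℝ) : ℝ≥0∞ :=
  Filter.limsup
    (fun δ : ℝ => m (Metric.closedBall x₀ (r + δ) \ Metric.ball x₀ r) / ENNReal.ofReal δ) (𝓝[>] 0)

end ReducedCD

end

/-! Apply the curvature condition to the uniform measures on a tiny ball around `x₀` and on a set
`A`. A measure at time `t` on a Wasserstein geodesic lives near points `y` with `d(x,y) = t d(x,z)`,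
so the distances to `x₀` of its points are nearly `t` times those of points of `A`. Jensen's
inequality bounds its entropy by the volume of the set carrying it. This gives a Brunn–Minkowski
inequality for contraction towards `x₀` (`CDStar.rpow_mul_measure_le`).

With a crude lower bound for `sigma` it compares concentric balls uniformly in the centre
(`CDStar.exists_mul_closedBall_le`), whence finiteness and total boundedness of bounded sets;
completeness then gives compactness.

With `sigma` bounded below by quotients of `w = sin` or `sinh`, it becomes an inequality for the law
`μ` of `dist · x₀` under `m`: scaling by `t` loses at most the factor `(w(tθ)/w(θ))^N`
(`CDStar.rpow_mul_map_le`). On `[R, R+δ]` this compares spheres. For balls,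
`measure_mul_lintegral_le` integrates it over all `t` by Fubini, so neither differentiability nor
absolute continuity of `v` is needed. -/

namespace ReducedCD

open MeasureTheory ProbabilityTheory

/-! ### Couplings and the metric inequality for intermediate points -/

/-- Two finite measures on products which share a marginal can be glued along it. -/
lemma exists_gluing {X Y Z : Type*} [MeasurableSpace X] [MeasurableSpace Y] [MeasurableSpace Z]
    [StandardBorelSpace X] [StandardBorelSpace Z] [Nonempty X] [Nonempty Z]
    (q₁ : Measure (X × Y)) (q₂ : Measure (Y × Z)) [IsFiniteMeasure q₁] [IsFiniteMeasure q₂]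
    (h : q₁.map Prod.snd = q₂.map Prod.fst) :
    ∃ π : Measure (Y × X × Z),
      π.map (fun p => (p.2.1, p.1)) = q₁ ∧ π.map (fun p => (p.1, p.2.2)) = q₂ := by
  set q := q₁.map Prod.swap with hq
  have hq_fst : q.fst = q₂.fst := by
    rw [Measure.fst, hq, Measure.map_map measurable_fst measurable_swap, Measure.fst, ← h]
    rfl
  -- The outer coordinates are made conditionally independent given the shared one.
  refine ⟨q₂.fst ⊗ₘ (q.condKernel ×ₖ q₂.condKernel), ?_, ?_⟩
  · have h1 : (q₂.fst ⊗ₘ (q.condKernel ×ₖ q₂.condKernel)).map (Prod.map id Prod.fst) = q := by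
      rw [← Measure.compProd_map measurable_fst, ← Kernel.fst_eq, Kernel.fst_prod, ← hq_fst,
        Measure.disintegrate]
    have h2 : (fun p : Y × X × Z => (p.2.1, p.1)) = Prod.swap ∘ Prod.map id Prod.fst := rfl
    rw [h2, ← Measure.map_map measurable_swap (by fun_prop), h1, hq,
      Measure.map_map measurable_swap measurable_swap, Prod.swap_swap_eq, Measure.map_id]
  · have h1 : (q₂.fst ⊗ₘ (q.condKernel ×ₖ q₂.condKernel)).map (Prod.map id Prod.snd) = q₂ := by
      rw [← Measure.compProd_map measurable_snd, ← Kernel.snd_eq, Kernel.snd_prod,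
        Measure.disintegrate]
    exact h1

lemma IsCoupling.isProbabilityMeasure {M : Type*} [MeasurableSpace M] {μ ν : Measure M} {q : Measure (M × M)}
    (hq : IsCoupling q μ ν) [IsProbabilityMeasure μ] : IsProbabilityMeasure q := by
  have : IsProbabilityMeasure (q.map Prod.fst) := hq.1 ▸ inferInstance
  exact Measure.isProbabilityMeasure_of_map Prod.fst

/-- With `a = d(x,y)` and `c = d(x,z)`, the triangle inequality gives `d(y,z)² ≥ (c - a)²`, and
`(1-t)a² + t(c-a)² = (a-tc)² + t(1-t)c²`. The excess cost thus controls how far `y` is from being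
`t`-intermediate. -/
lemma intermediate_inequality {M : Type*} [MetricSpace M] (x y z : M) {t : ℝ} (h0 : 0 ≤ t)
    (h1 : t ≤ 1) :
    ENNReal.ofReal ((dist x y - t * dist x z) ^ 2) +
        ENNReal.ofReal (t * (1 - t)) * edist x z ^ 2 ≤
      ENNReal.ofReal (1 - t) * edist x y ^ 2 + ENNReal.ofReal t * edist y z ^ 2 := by
  have h1' : 0 ≤ 1 - t := by linarith
  have e (a b : M) : edist a b ^ 2 = ENNReal.ofReal (dist a b ^ 2) := by
    rw [edist_dist, ENNReal.ofReal_pow dist_nonneg]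
  simp only [e]
  rw [← ENNReal.ofReal_mul (by positivity), ← ENNReal.ofReal_mul h1', ← ENNReal.ofReal_mul h0,
    ← ENNReal.ofReal_add (by positivity) (by positivity),
    ← ENNReal.ofReal_add (by positivity) (by positivity)]
  refine ENNReal.ofReal_le_ofReal ?_
  have hsq : (dist x z - dist x y) ^ 2 ≤ dist y z ^ 2 := by
    refine sq_le_sq.2 ?_
    rw [abs_of_nonneg (dist_nonneg (x := y)), dist_comm x z, dist_comm x y, dist_comm y z]
    exact abs_dist_sub_le z y x
  nlinarith [mul_le_mul_of_nonneg_left hsq h0]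

/-! ### Concentration of Wasserstein intermediate measures -/

section Wasserstein

variable {M : Type*} [MetricSpace M] [MeasurableSpace M]

lemma wasserstein_sq_le_cost {μ ν : Measure M} {q : Measure (M × M)} (hq : IsCoupling q μ ν) :
    wasserstein μ ν ^ 2 ≤ cost q := by
  have h : wasserstein μ ν ≤ cost q ^ (1 / 2 : ℝ) := iInf₂_le q hq
  calc wasserstein μ ν ^ 2 ≤ (cost q ^ (1 / 2 : ℝ)) ^ 2 := by gcongr
    _ = cost q := by
      rw [← ENNReal.rpow_natCast, ← ENNReal.rpow_mul]; norm_num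

lemma exists_coupling_cost_le {μ ν : Measure M} (hW : wasserstein μ ν ≠ ∞) {δ : ℝ≥0∞}
    (hδ : 0 < δ) : ∃ q, IsCoupling q μ ν ∧ cost q ≤ wasserstein μ ν ^ 2 + δ := by
  have h1 : wasserstein μ ν < (wasserstein μ ν ^ 2 + δ) ^ (1 / 2 : ℝ) := by
    rw [← ENNReal.rpow_lt_rpow_iff (z := 2) (by norm_num), ← ENNReal.rpow_mul]
    norm_num
    exact ENNReal.lt_add_right (by simp [hW]) hδ.ne'
  conv_lhs at h1 => rw [wasserstein]
  obtain ⟨q, hq⟩ := iInf_lt_iff.1 h1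
  obtain ⟨hc, hq⟩ := iInf_lt_iff.1 hq
  exact ⟨q, hc, ((ENNReal.rpow_lt_rpow_iff (by norm_num)).1 hq).le⟩

lemma wasserstein_ne_top [BorelSpace M] {μ ν : Measure M} [IsProbabilityMeasure μ]
    [IsProbabilityMeasure ν]
    {A B : Set M} (hA : Bornology.IsBounded A) (hB : Bornology.IsBounded B)
    (hμ : ∀ᵐ x ∂μ, x ∈ A) (hν : ∀ᵐ x ∂ν, x ∈ B) : wasserstein μ ν ≠ ∞ := by
  obtain ⟨C, hC⟩ := Metric.isBounded_iff.1 (hA.union hB)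
  have hq : IsCoupling (μ.prod ν) μ ν := ⟨by simp, by simp⟩
  have hcost : cost (μ.prod ν) ≤ ENNReal.ofReal C ^ 2 := by
    calc cost (μ.prod ν) ≤ ∫⁻ _, ENNReal.ofReal C ^ 2 ∂(μ.prod ν) := by
          refine lintegral_mono_ae ?_
          have h1 : ∀ᵐ p ∂(μ.prod ν), p.1 ∈ A := Measure.quasiMeasurePreserving_fst.ae hμ
          have h2 : ∀ᵐ p ∂(μ.prod ν), p.2 ∈ B := Measure.quasiMeasurePreserving_snd.ae hν
          filter_upwards [h1, h2] with p hp1 hp2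
          gcongr
          rw [edist_dist]
          exact ENNReal.ofReal_le_ofReal (hC (Or.inl hp1) (Or.inr hp2))
      _ = _ := by simp
  intro h
  have := (wasserstein_sq_le_cost hq).trans hcost
  rw [h] at this
  simp at this

/-- A measure dividing the Wasserstein distance of `μ` and `κ` in the ratio `t : 1 - t` is
concentrated on approximate `t`-intermediate points. -/
lemma ae_mem_of_wasserstein_intermediate [CompleteSpace M] [TopologicalSpace.SeparableSpace M]
    [BorelSpace M] {μ ν κ : Measure M} [IsProbabilityMeasure μ] [IsProbabilityMeasure ν]
    [IsProbabilityMeasure κ] (hW : wasserstein μ κ ≠ ∞) {t : ℝ} (h0 : 0 ≤ t) (h1 : t ≤ 1)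
    (hμν : wasserstein μ ν = ENNReal.ofReal t * wasserstein μ κ)
    (hνκ : wasserstein ν κ = ENNReal.ofReal (1 - t) * wasserstein μ κ)
    {A B D : Set M} (hA : ∀ᵐ x ∂μ, x ∈ A) (hB : ∀ᵐ x ∂κ, x ∈ B) (hD : MeasurableSet D)
    {η : ℝ} (hη : 0 < η)
    (h : ∀ x ∈ A, ∀ z ∈ B, ∀ y, |dist x y - t * dist x z| < η → y ∈ D) :
    ∀ᵐ y ∂ν, y ∈ D := by
  have : SecondCountableTopology M := UniformSpace.secondCountable_of_separable M
  have : Nonempty M := μ.nonempty_of_neZero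
  set W := wasserstein μ κ with hWdef
  -- Near-optimal couplings are glued and Chebyshev is applied; letting `δ → 0` makes the existence
  -- of optimal couplings unnecessary.
  have key : ∀ δ : ℝ≥0∞, 0 < δ → ENNReal.ofReal (η ^ 2) * ν Dᶜ ≤ δ := by
    intro δ hδ
    obtain ⟨q₁, hq₁, hc₁⟩ := exists_coupling_cost_le (μ := μ) (ν := ν)
      (by rw [hμν]; exact ENNReal.mul_ne_top ENNReal.ofReal_ne_top hW) hδ
    obtain ⟨q₂, hq₂, hc₂⟩ := exists_coupling_cost_le (μ := ν) (ν := κ)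
      (by rw [hνκ]; exact ENNReal.mul_ne_top ENNReal.ofReal_ne_top hW) hδ
    have := hq₁.isProbabilityMeasure
    have := hq₂.isProbabilityMeasure
    obtain ⟨π, hπ₁, hπ₂⟩ := exists_gluing q₁ q₂ (hq₁.2.trans hq₂.1.symm)
    have hx : π.map (fun p => p.2.1) = μ := by
      rw [← hq₁.1, ← hπ₁, Measure.map_map (by fun_prop) (by fun_prop)]; rfl
    have hy : π.map (fun p => p.1) = ν := by
      rw [← hq₁.2, ← hπ₁, Measure.map_map (by fun_prop) (by fun_prop)]; rfl
    have hz : π.map (fun p => p.2.2) = κ := by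
      rw [← hq₂.2, ← hπ₂, Measure.map_map (by fun_prop) (by fun_prop)]; rfl
    have hxz : IsCoupling (π.map Prod.snd) μ κ := by
      refine ⟨?_, ?_⟩
      · rw [Measure.map_map (by fun_prop) (by fun_prop), ← hx]; rfl
      · rw [Measure.map_map (by fun_prop) (by fun_prop), ← hz]; rfl
    have hcost₁ : ∫⁻ p, edist p.2.1 p.1 ^ 2 ∂π = cost q₁ := by
      rw [cost, ← hπ₁, lintegral_map (by fun_prop) (by fun_prop)]
    have hcost₂ : ∫⁻ p, edist p.1 p.2.2 ^ 2 ∂π = cost q₂ := by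
      rw [cost, ← hπ₂, lintegral_map (by fun_prop) (by fun_prop)]
    have hcost₃ : ∫⁻ p, edist p.2.1 p.2.2 ^ 2 ∂π = cost (π.map Prod.snd) := by
      rw [cost, lintegral_map (by fun_prop) (by fun_prop)]
    set g : M × M × M → ℝ≥0∞ :=
      fun p => ENNReal.ofReal ((dist p.2.1 p.1 - t * dist p.2.1 p.2.2) ^ 2) with hg
    have hgm : Measurable g := by fun_prop
    set T := ENNReal.ofReal t with hT
    set T' := ENNReal.ofReal (1 - t) with hT'
    have hTT' : ENNReal.ofReal (t * (1 - t)) = T * T' := ENNReal.ofReal_mul h0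
    have hT1 : T + T' = 1 := by
      rw [hT, hT', ← ENNReal.ofReal_add h0 (by linarith)]; simp
    have hint : ∫⁻ p, g p ∂π + T * T' * cost (π.map Prod.snd) ≤ T' * cost q₁ + T * cost q₂ := by
      rw [← hcost₁, ← hcost₂, ← hcost₃, ← lintegral_const_mul _ (by fun_prop),
        ← lintegral_const_mul _ (by fun_prop), ← lintegral_const_mul _ (by fun_prop),
        ← lintegral_add_left hgm, ← lintegral_add_left (by fun_prop), ← hTT']
      exact lintegral_mono fun p => intermediate_inequality p.2.1 p.1 p.2.2 h0 h1
    -- Since `(1-t)t² + t(1-t)² = t(1-t)`, the main terms cancel exactly and only the error of the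
    -- couplings remains.
    have hint' : ∫⁻ p, g p ∂π ≤ δ := by
      have hfin : T * T' * W ^ 2 ≠ ∞ := by
        refine ENNReal.mul_ne_top (ENNReal.mul_ne_top ?_ ?_) (ENNReal.pow_ne_top hW) <;>
          exact ENNReal.ofReal_ne_top
      refine (ENNReal.add_le_add_iff_right hfin).1 ?_
      calc ∫⁻ p, g p ∂π + T * T' * W ^ 2
          ≤ ∫⁻ p, g p ∂π + T * T' * cost (π.map Prod.snd) := by
            gcongr; exact wasserstein_sq_le_cost hxz
        _ ≤ T' * cost q₁ + T * cost q₂ := hint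
        _ ≤ T' * ((T * W) ^ 2 + δ) + T * ((T' * W) ^ 2 + δ) := by
            rw [hμν] at hc₁; rw [hνκ] at hc₂
            gcongr
        _ = (T + T') * δ + T * T' * W ^ 2 * (T + T') := by ring
        _ = δ + T * T' * W ^ 2 := by rw [hT1]; ring
    have hA' : ∀ᵐ p ∂π, p.2.1 ∈ A := by
      rw [← hx] at hA
      exact ae_of_ae_map (by fun_prop) hA
    have hB' : ∀ᵐ p ∂π, p.2.2 ∈ B := by
      rw [← hz] at hB
      exact ae_of_ae_map (by fun_prop) hB
    calc ENNReal.ofReal (η ^ 2) * ν Dᶜ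
        = ENNReal.ofReal (η ^ 2) * π ((fun p => p.1) ⁻¹' Dᶜ) := by
          rw [← hy, Measure.map_apply (by fun_prop) hD.compl]
      _ ≤ ENNReal.ofReal (η ^ 2) * π {p | ENNReal.ofReal (η ^ 2) ≤ g p} := by
          gcongr 1
          refine measure_mono_ae ?_
          filter_upwards [hA', hB'] with p hpA hpB hpD
          by_contra hcon
          refine hpD (h _ hpA _ hpB _ ?_)
          have hlt : g p < ENNReal.ofReal (η ^ 2) := not_le.1 hcon
          exact (sq_lt_sq.1 (ENNReal.ofReal_lt_ofReal_iff'.1 hlt).1).trans_eq (abs_of_pos hη)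
      _ ≤ ∫⁻ p, g p ∂π := mul_meas_ge_le_lintegral₀ hgm.aemeasurable _
      _ ≤ δ := hint'
  have h2 : ENNReal.ofReal (η ^ 2) * ν Dᶜ ≤ 0 :=
    le_of_forall_gt_imp_ge_of_dense fun δ hδ => key δ hδ
  have h3 := (mul_eq_zero.1 (nonpos_iff_eq_zero.1 h2)).resolve_left
    (by simp; positivity)
  exact h3

end Wasserstein

/-! ### Densities: Jensen's inequality and uniform measures -/

section Density

variable {X : Type*} [MeasurableSpace X]

/-- Jensen for the concave power `1/N` reduces the claim to `∫ ρ⁻¹ dν ≤ m G`, which holds because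
`dν = ρ dm` and `ρ ρ⁻¹ ≤ 1`. -/
lemma lintegral_rnDeriv_rpow_neg_le {m ν : Measure X} [SigmaFinite m] [IsProbabilityMeasure ν]
    (hν : ν ≪ m) {N : ℝ} (hN : 1 ≤ N) {G : Set X} (hG : MeasurableSet G)
    (h : ∀ᵐ y ∂ν, y ∈ G) :
    ∫⁻ x, (ν.rnDeriv m x) ^ (-(1 / N)) ∂ν ≤ m G ^ (1 / N) := by
  have hN0 : 0 < N := by linarith
  set ρ := ν.rnDeriv m with hρ
  have hρm : Measurable ρ := Measure.measurable_rnDeriv ν m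
  have h1 : ∫⁻ x, (ρ x)⁻¹ ∂ν ≤ m G := by
    calc ∫⁻ x, (ρ x)⁻¹ ∂ν = ∫⁻ x, G.indicator (fun x => (ρ x)⁻¹) x ∂ν := by
          refine lintegral_congr_ae ?_
          filter_upwards [h] with x hx
          rw [Set.indicator_of_mem hx]
      _ = ∫⁻ x, ρ x * G.indicator (fun x => (ρ x)⁻¹) x ∂m :=
          (lintegral_rnDeriv_mul hν (hρm.inv.indicator hG).aemeasurable).symm
      _ ≤ ∫⁻ x, G.indicator 1 x ∂m := by
          refine lintegral_mono fun x => ?_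
          by_cases hx : x ∈ G
          · simp [hx, ENNReal.mul_inv_le_one]
          · simp [hx]
      _ = m G := lintegral_indicator_one hG
  have h2 := eLpNorm'_le_eLpNorm'_of_exponent_le (f := fun x => (ρ x)⁻¹) (p := 1 / N) (q := 1)
    (by positivity) (by rw [div_le_one hN0]; exact hN) ν hρm.inv.aestronglyMeasurable
  simp only [eLpNorm', enorm_eq_self, ENNReal.rpow_one, one_div, inv_inv, inv_one] at h2
  have h3 : ∫⁻ x, (ρ x) ^ (-(1 / N)) ∂ν = ∫⁻ x, (ρ x)⁻¹ ^ N⁻¹ ∂ν := by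
    refine lintegral_congr fun x => ?_
    rw [ENNReal.rpow_neg, ENNReal.inv_rpow, one_div]
  rw [h3, one_div, ← ENNReal.rpow_inv_le_iff (by positivity), inv_inv]
  exact h2.trans h1

lemma ae_cond_mem {m : Measure X} {A : Set X} (hA : MeasurableSet A) :
    ∀ᵐ x ∂m[|A], x ∈ A :=
  Measure.smul_absolutelyContinuous.ae_le (ae_restrict_mem hA)

lemma rnDeriv_cond {m : Measure X} [SigmaFinite m] {A : Set X} (hA : MeasurableSet A)
    (h0 : m A ≠ 0) (hfin : m A ≠ ∞) : ∀ᵐ x ∂m[|A], m[|A].rnDeriv m x = (m A)⁻¹ := by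
  have : Fact (m A < ∞) := ⟨hfin.lt_top⟩
  have h1 := (Measure.rnDeriv_smul_left_of_ne_top (m.restrict A) m
    (ENNReal.inv_ne_top.2 h0))
  have h2 := Measure.rnDeriv_restrict_self m hA
  have hac : m[|A] ≪ m := cond_absolutelyContinuous
  filter_upwards [hac.ae_le h1, hac.ae_le h2, ae_cond_mem (m := m) hA] with x hx1 hx2 hx
  rw [ProbabilityTheory.cond, hx1, Pi.smul_apply, hx2]
  simp [hx]

end Density

/-! ### Brunn–Minkowski inequality for contractions -/

section BrunnMinkowski

variable {M : Type*} [MetricSpace M] [MeasurableSpace M]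

lemma memPInfty_cond {m : Measure M} {A : Set M} (hA : MeasurableSet A) (h0 : m A ≠ 0)
    (hfin : m A ≠ ∞) (hb : Bornology.IsBounded A) : MemPInfty m m[|A] where
  isProbabilityMeasure := cond_isProbabilityMeasure_of_finite h0 hfin
  absolutelyContinuous := cond_absolutelyContinuous
  isBounded_support := by
    refine hb.closure.subset (Measure.support_subset_of_isClosed isClosed_closure ?_)
    filter_upwards [ae_cond_mem (m := m) hA] with x hx using subset_closure hx

variable [BorelSpace M] [CompleteSpace M] [TopologicalSpace.SeparableSpace M] {m : Measure M}
  [IsLocallyFiniteMeasure m] {K N : ℝ}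

/-- A Brunn–Minkowski inequality for contractions towards a point of the support. -/
lemma CDStar.rpow_mul_measure_le (hCD : CDStar K N m) (hN : 1 ≤ N) {x₀ : M}
    (hx₀ : x₀ ∈ m.support) {t : ℝ} (ht : t ∈ Set.Ioo (0 : ℝ) 1) {C : Set ℝ} {ε : ℝ} (hε : 0 < ε)
    {c : ℝ≥0∞} (hc : ∀ θ ∈ Metric.cthickening ε C, 0 ≤ θ → c ≤ sigma K N t θ) {A : Set M}
    (hA : MeasurableSet A) (hb : Bornology.IsBounded A) (hfin : m A ≠ ∞)
    (hAC : ∀ a ∈ A, dist a x₀ ∈ C) :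
    c ^ N * m A ≤ m ((dist · x₀) ⁻¹' Metric.cthickening (3 * ε) ((t * ·) '' C)) := by
  have : SecondCountableTopology M := UniformSpace.secondCountable_of_separable M
  have hN0 : 0 < N := by linarith
  rcases eq_or_ne (m A) 0 with hA0 | hA0
  · simp [hA0]
  obtain ⟨ε', hε', hfin'⟩ := (m.finiteAt_nhds x₀).exists_mem_basis Metric.nhds_basis_ball
  -- `ε'` keeps the mass finite and `x₀ ∈ m.support` keeps it positive, so the uniform measure on
  -- `B` exists.
  set B := Metric.ball x₀ (min ε ε') with hB
  have hBfin : m B ≠ ∞ :=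
    ((measure_mono (Metric.ball_subset_ball (min_le_right _ _))).trans_lt hfin').ne
  have hB0 : m B ≠ 0 := ((Measure.mem_support_iff_forall x₀).1 hx₀ _
    (Metric.ball_mem_nhds _ (lt_min hε hε'))).ne'
  have hBm : MeasurableSet B := Metric.isOpen_ball.measurableSet
  have hP0 := memPInfty_cond (m := m) hBm hB0 hBfin Metric.isBounded_ball
  have hP1 := memPInfty_cond (m := m) hA hA0 hfin hb
  have := hP0.isProbabilityMeasure
  have := hP1.isProbabilityMeasure
  obtain ⟨q, Γ, hq, hΓ, hS⟩ := hCD _ _ hP0 hP1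
  have htI : t ∈ Set.Icc (0 : ℝ) 1 := ⟨ht.1.le, ht.2.le⟩
  have hΓt := hΓ.mem t htI
  have := hΓt.isProbabilityMeasure
  set G := (dist · x₀) ⁻¹' Metric.cthickening (3 * ε) ((t * ·) '' C) with hG
  have hGm : MeasurableSet G :=
    (Metric.isClosed_cthickening.preimage (by fun_prop)).measurableSet
  have hGae : ∀ᵐ y ∂(Γ t), y ∈ G := by
    refine ae_mem_of_wasserstein_intermediate (μ := m[|B]) (κ := m[|A])
      (wasserstein_ne_top Metric.isBounded_ball hb (ae_cond_mem hBm) (ae_cond_mem hA))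
      ht.1.le ht.2.le ?_ ?_ (ae_cond_mem hBm) (ae_cond_mem hA) hGm hε ?_
    · have := hΓ.dist_eq 0 (by simp) t htI
      rwa [hΓ.zero, zero_sub, abs_neg, abs_of_pos ht.1] at this
    · have := hΓ.dist_eq t htI 1 (by simp)
      rwa [hΓ.one, abs_sub_comm, abs_of_pos (by linarith [ht.2])] at this
    · intro x hx z hz y hy
      -- Three errors of at most `ε`: replacing `x₀` by `x` in the distance to `y`, the defect of
      -- `y`, and replacing `x₀` by `x` in the distance to `z`.
      refine Metric.mem_cthickening_of_dist_le _ (t * dist z x₀) _ _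
        (Set.mem_image_of_mem _ (hAC z hz)) ?_
      have hx' : dist x x₀ < ε := (Metric.mem_ball.1 hx).trans_le (min_le_left _ _)
      have e1 := abs_dist_sub_le x₀ x y
      have e2 := abs_dist_sub_le x₀ x z
      rw [dist_comm x₀ x, dist_comm x₀ y] at e1
      rw [dist_comm x₀ x, dist_comm x₀ z] at e2
      rw [Real.dist_eq, abs_le]
      rw [abs_le] at e1 e2
      rw [abs_lt] at hy
      constructor <;> nlinarith [ht.1, ht.2]
  have hS' := hS t htI N le_rfl
  rw [renyiEntropy, EReal.neg_le_neg_iff, EReal.coe_ennreal_le_coe_ennreal_iff] at hS'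
  have hlow : c * m A ^ (1 / N) ≤ m G ^ (1 / N) := by
    refine le_trans ?_ (hS'.trans
      (lintegral_rnDeriv_rpow_neg_le hΓt.absolutelyContinuous hN hGm hGae))
    have hqp := hq.1.isProbabilityMeasure
    calc c * m A ^ (1 / N) = ∫⁻ _, c * m A ^ (1 / N) ∂q := by simp
      _ ≤ _ := by
        refine lintegral_mono_ae ?_
        have hfst : ∀ᵐ p ∂q, p.1 ∈ B := by
          have := ae_cond_mem (m := m) hBm
          rw [← hq.1.1] at this
          exact ae_of_ae_map measurable_fst.aemeasurable this
        have hsnd : ∀ᵐ p ∂q, p.2 ∈ A ∧ m[|A].rnDeriv m p.2 = (m A)⁻¹ := by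
          have := (ae_cond_mem (m := m) hA).and (rnDeriv_cond hA hA0 hfin)
          exact ae_of_ae_map measurable_snd.aemeasurable (hq.1.2.symm ▸ this :
            ∀ᵐ z ∂(q.map Prod.snd), z ∈ A ∧ m[|A].rnDeriv m z = (m A)⁻¹)
        filter_upwards [hfst, hsnd] with p hp1 hp2
        -- The contribution of the small ball `B` is discarded.
        refine le_trans ?_ (self_le_add_left _ _)
        rw [hp2.2]
        gcongr
        · refine hc _ (Metric.mem_cthickening_of_dist_le _ _ _ _ (hAC _ hp2.1) ?_) dist_nonneg
          have h1 : dist p.1 x₀ < ε := (Metric.mem_ball.1 hp1).trans_le (min_le_left _ _)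
          have e1 := abs_dist_sub_le p.1 x₀ p.2
          rw [dist_comm x₀ p.2] at e1
          exact e1.trans h1.le
        · rw [ENNReal.rpow_neg, ENNReal.inv_rpow, inv_inv]
  calc c ^ N * m A = (c * m A ^ (1 / N)) ^ N := by
        rw [ENNReal.mul_rpow_of_nonneg _ _ hN0.le, ← ENNReal.rpow_mul]
        simp [hN0.ne']
    _ ≤ (m G ^ (1 / N)) ^ N := by gcongr
    _ = m G := by rw [← ENNReal.rpow_mul]; simp [hN0.ne']

end BrunnMinkowski

/-! ### Explicit forms and lower bounds of the distortion coefficients -/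

section Sigma

lemma sigma_zero_right {K N t : ℝ} (hN : 0 < N) : sigma K N t 0 = ENNReal.ofReal t := by
  have : ¬ N * Real.pi ^ 2 ≤ 0 := by push Not; positivity
  simp [sigma, frakS, this]

lemma sigma_zero_left {N t θ : ℝ} (hN : 0 < N) : sigma 0 N t θ = ENNReal.ofReal t := by
  have : ¬ N * Real.pi ^ 2 ≤ 0 := by push Not; positivity
  simp [sigma, frakS, this]

lemma mul_pi_sq_le_iff {K N θ : ℝ} (hK : 0 < K) (hN : 0 < N) (hθ : 0 < θ) :
    N * Real.pi ^ 2 ≤ K * θ ^ 2 ↔ Real.pi ≤ √(K / N) * θ := by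
  have h : K * θ ^ 2 = N * (√(K / N) * θ) ^ 2 := by
    rw [mul_pow, Real.sq_sqrt (by positivity)]; field_simp
  rw [h, mul_le_mul_iff_right₀ hN, pow_le_pow_iff_left₀ Real.pi_pos.le (by positivity) two_ne_zero]

lemma sigma_of_pi_le {K N t θ : ℝ} (hK : 0 < K) (hN : 0 < N) (hθ : 0 < θ)
    (h : Real.pi ≤ √(K / N) * θ) : sigma K N t θ = ∞ := by
  rw [sigma, if_pos ((mul_pi_sq_le_iff hK hN hθ).2 h)]

lemma sigma_of_lt_pi {K N t θ : ℝ} (hK : 0 < K) (hN : 0 < N) (ht : 0 < t) (hθ : 0 < θ)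
    (h : √(K / N) * θ < Real.pi) :
    sigma K N t θ = ENNReal.ofReal (Real.sin (√(K / N) * (t * θ)) / Real.sin (√(K / N) * θ)) := by
  have hk : 0 < K / N := by positivity
  have ha : 0 < √(K / N) := Real.sqrt_pos.2 hk
  have hs : 0 < Real.sin (√(K / N) * θ) := Real.sin_pos_of_pos_of_lt_pi (by positivity) h
  rw [sigma, if_neg (by rw [mul_pi_sq_le_iff hK hN hθ]; exact not_le.2 h), frakS, frakS,
    if_neg (by push Not; constructor <;> positivity), if_pos hk,
    if_neg (by push Not; constructor <;> positivity), if_pos hk]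
  congr 1
  field_simp

lemma sigma_of_neg {K N t θ : ℝ} (hK : K < 0) (hN : 0 < N) (ht : 0 < t) (hθ : 0 < θ) :
    sigma K N t θ =
      ENNReal.ofReal (Real.sinh (√(-K / N) * (t * θ)) / Real.sinh (√(-K / N) * θ)) := by
  have hk : K / N < 0 := div_neg_of_neg_of_pos hK hN
  have ha : 0 < √(-(K / N)) := Real.sqrt_pos.2 (by linarith)
  have hs : 0 < Real.sinh (√(-(K / N)) * θ) := Real.sinh_pos_iff.2 (by positivity)
  have hneg : ¬ N * Real.pi ^ 2 ≤ K * θ ^ 2 := by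
    have h1 : 0 < N * Real.pi ^ 2 := by positivity
    nlinarith [sq_nonneg θ]
  rw [sigma, if_neg hneg, frakS, frakS, if_neg (by push Not; constructor <;> [exact hk.ne; positivity]),
    if_neg hk.not_gt, if_neg (by push Not; constructor <;> [exact hk.ne; positivity]),
    if_neg hk.not_gt, neg_div]
  congr 1
  field_simp

lemma mul_sin_le_sin_mul {t x : ℝ} (ht0 : 0 ≤ t) (ht1 : t ≤ 1) (hx0 : 0 ≤ x) (hx : x ≤ Real.pi) :
    t * Real.sin x ≤ Real.sin (t * x) := by
  have := strictConcaveOn_sin_Icc.concaveOn.2 (⟨le_rfl, Real.pi_pos.le⟩ : (0 : ℝ) ∈ Set.Icc 0 Real.pi)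
    (⟨hx0, hx⟩ : x ∈ Set.Icc 0 Real.pi) (by linarith : 0 ≤ 1 - t) ht0 (by ring)
  simpa using this

lemma sinh_le_mul_exp (x : ℝ) : Real.sinh x ≤ x * Real.exp x := by
  have h1 := Real.add_one_le_exp (-(2 * x))
  have h2 : Real.exp (-x) = Real.exp x * Real.exp (-(2 * x)) := by
    rw [← Real.exp_add]; ring_nf
  rw [Real.sinh_eq, h2]
  nlinarith [Real.exp_pos x]

lemma self_le_sinh {x : ℝ} (hx : 0 ≤ x) : x ≤ Real.sinh x := Real.self_le_sinh_iff.2 hx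

/-- The distortion coefficients are bounded below on bounded intervals. -/
lemma exists_le_sigma (K : ℝ) {N t : ℝ} (hN : 0 < N) (ht0 : 0 < t) (ht1 : t ≤ 1) (X : ℝ) :
    ∃ κ : ℝ≥0∞, κ ≠ 0 ∧ ∀ θ, 0 ≤ θ → θ ≤ X → κ ≤ sigma K N t θ := by
  rcases lt_or_ge K 0 with hK | hK
  · set a := √(-K / N)
    have ha : 0 < a := Real.sqrt_pos.2 (div_pos (by linarith) hN)
    -- From `x ≤ sinh x ≤ x eˣ`. For `K ≥ 0` the constant is `t`, by concavity of the sine on `[0,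
    -- π]`.
    refine ⟨ENNReal.ofReal (t * Real.exp (-(a * X))), by simpa using by positivity, ?_⟩
    intro θ h0 hX
    rcases h0.eq_or_lt with rfl | hθ
    · rw [sigma_zero_right hN]
      refine ENNReal.ofReal_le_ofReal (mul_le_of_le_one_right ht0.le (Real.exp_le_one_iff.2 ?_))
      have := mul_nonneg ha.le hX
      linarith
    · rw [sigma_of_neg hK hN ht0 hθ]
      refine ENNReal.ofReal_le_ofReal ?_
      have hs : 0 < Real.sinh (a * θ) := Real.sinh_pos_iff.2 (by positivity)
      rw [le_div_iff₀ hs]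
      calc t * Real.exp (-(a * X)) * Real.sinh (a * θ)
          ≤ t * Real.exp (-(a * θ)) * (a * θ * Real.exp (a * θ)) := by
            gcongr
            exact sinh_le_mul_exp _
        _ = a * (t * θ) * (Real.exp (-(a * θ)) * Real.exp (a * θ)) := by ring
        _ = a * (t * θ) := by rw [← Real.exp_add]; simp
        _ ≤ _ := self_le_sinh (by positivity)
  · refine ⟨ENNReal.ofReal t, by simpa using ht0, fun θ h0 _ => ?_⟩
    rcases hK.eq_or_lt with rfl | hK
    · rw [sigma_zero_left hN]
    rcases h0.eq_or_lt with rfl | hθ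
    · rw [sigma_zero_right hN]
    rcases le_or_gt Real.pi (√(K / N) * θ) with h | h
    · rw [sigma_of_pi_le hK hN hθ h]; exact le_top
    · rw [sigma_of_lt_pi hK hN ht0 hθ h]
      refine ENNReal.ofReal_le_ofReal ?_
      have ha : 0 < √(K / N) := Real.sqrt_pos.2 (by positivity)
      have hs : 0 < Real.sin (√(K / N) * θ) := Real.sin_pos_of_pos_of_lt_pi (by positivity) h
      rw [le_div_iff₀ hs, mul_left_comm]
      exact mul_sin_le_sin_mul ht0.le ht1 (by positivity) h.le

end Sigma

/-! ### Finiteness and compactness of bounded subsets of the support -/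

section Compactness

lemma closedBall_pos_of_mem_support {M : Type*} [MetricSpace M] [MeasurableSpace M] {m : Measure M}
    {x : M} (hx : x ∈ m.support) {r : ℝ} (hr : 0 < r) :
    0 < m (Metric.closedBall x r) :=
  (Measure.mem_support_iff_forall x).1 hx _ (Metric.closedBall_mem_nhds _ hr)

variable {M : Type*} [MetricSpace M] [MeasurableSpace M] [BorelSpace M] [CompleteSpace M]
  [TopologicalSpace.SeparableSpace M] {m : Measure M} [IsLocallyFiniteMeasure m] {K N : ℝ}

/-- A doubling-type estimate: the ball of radius `R` is contracted towards its centre into the ball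
of radius `r`. The constant must not depend on `x`, as total boundedness uses it at infinitely many
centres. -/
lemma CDStar.exists_mul_closedBall_le (hCD : CDStar K N m) (hN : 1 ≤ N) {R r : ℝ} (hR : 0 < R)
    (hr : 0 < r) :
    ∃ κ : ℝ≥0∞, κ ≠ 0 ∧ ∀ x ∈ m.support,
      κ * m (Metric.closedBall x R) ≤ m (Metric.closedBall x r) := by
  have : SecondCountableTopology M := UniformSpace.secondCountable_of_separable M
  have hN0 : 0 < N := by linarith
  set t := min (1 / 2) (r / (2 * R)) with ht
  have ht0 : 0 < t := by positivity
  have ht1 : t < 1 := (min_le_left _ _).trans_lt (by norm_num)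
  have htR : t * R ≤ r / 2 := by
    calc t * R ≤ r / (2 * R) * R := by gcongr; exact min_le_right _ _
      _ = r / 2 := by field_simp
  obtain ⟨κ, hκ, hσ⟩ := exists_le_sigma K hN0 ht0 ht1.le (R + r / 6)
  refine ⟨κ ^ N, by simp [hκ, hN0.le, hN0], fun x hx => ?_⟩
  -- The larger ball is not yet known to have finite mass, so it is exhausted by sets of finite
  -- measure. With `tR ≤ r/2` and thickening `3 · r/6`, the contracted set stays within radius `r`.
  have key : ∀ n, κ ^ N * m (spanningSets m n ∩ Metric.closedBall x R) ≤
      m (Metric.closedBall x r) := by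
    intro n
    refine (hCD.rpow_mul_measure_le hN hx ⟨ht0, ht1⟩ (C := Metric.closedBall 0 R)
      (ε := r / 6) (by positivity) ?_ ((measurableSet_spanningSets m n).inter
        Metric.isClosed_closedBall.measurableSet)
        (Metric.isBounded_closedBall.subset Set.inter_subset_right) ?_ ?_).trans ?_
    · intro θ hθ h0
      rw [cthickening_closedBall (by positivity) hR.le, mem_closedBall_zero_iff,
        Real.norm_of_nonneg h0] at hθ
      exact hσ θ h0 (by linarith)
    · exact ((measure_mono Set.inter_subset_left).trans_lt (measure_spanningSets_lt_top m n)).ne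
    · intro a ha
      rw [mem_closedBall_zero_iff, Real.norm_of_nonneg dist_nonneg]
      exact ha.2
    · refine measure_mono fun y hy => ?_
      have hsub : (t * ·) '' Metric.closedBall (0 : ℝ) R ⊆ Metric.closedBall 0 (t * R) := by
        rintro _ ⟨θ, hθ, rfl⟩
        rw [mem_closedBall_zero_iff] at hθ ⊢
        rw [norm_mul, Real.norm_of_nonneg ht0.le]
        gcongr
      have h1 := Metric.cthickening_subset_of_subset (3 * (r / 6)) hsub hy
      rw [cthickening_closedBall (by positivity) (by positivity), mem_closedBall_zero_iff,
        Real.norm_of_nonneg dist_nonneg] at h1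
      exact Metric.mem_closedBall.2 (by linarith)
  have hmono : Monotone fun n => spanningSets m n ∩ Metric.closedBall x R :=
    fun i j hij => Set.inter_subset_inter_left _ (monotone_spanningSets m hij)
  rw [← Set.univ_inter (Metric.closedBall x R), ← iUnion_spanningSets m, Set.iUnion_inter,
    hmono.measure_iUnion, ENNReal.mul_iSup]
  exact iSup_le key

lemma CDStar.closedBall_ne_top (hCD : CDStar K N m) (hN : 1 ≤ N) {x : M} (hx : x ∈ m.support)
    (R : ℝ) : m (Metric.closedBall x R) ≠ ∞ := by
  obtain ⟨r, hr, hfin⟩ := (m.finiteAt_nhds x).exists_mem_basis Metric.nhds_basis_closedBall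
  obtain ⟨κ, hκ, h⟩ := hCD.exists_mul_closedBall_le hN (R := max R 1) (by positivity) hr
  intro htop
  have h1 : m (Metric.closedBall x (max R 1)) = ∞ :=
    measure_mono_top (Metric.closedBall_subset_closedBall (le_max_left _ _)) htop
  have h2 := h x hx
  rw [h1, ENNReal.mul_top hκ, top_le_iff] at h2
  exact hfin.ne h2

lemma CDStar.measure_lt_top (hCD : CDStar K N m) (hN : 1 ≤ N) {A : Set M} (hA : A ⊆ m.support)
    (hb : Bornology.IsBounded A) : m A < ∞ := by
  rcases A.eq_empty_or_nonempty with rfl | ⟨x, hx⟩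
  · simp
  obtain ⟨R, hR⟩ := hb.subset_closedBall x
  exact (measure_mono hR).trans_lt (hCD.closedBall_ne_top hN (hA hx) R).lt_top

/-- Otherwise there is an infinite `ε`-separated sequence. The disjoint balls of radius `ε/3` around
it would have masses bounded below, yet all lie in one ball of finite mass. -/
lemma CDStar.totallyBounded (hCD : CDStar K N m) (hN : 1 ≤ N) {A : Set M} (hA : A ⊆ m.support)
    (hb : Bornology.IsBounded A) : TotallyBounded A := by
  rcases A.eq_empty_or_nonempty with rfl | ⟨x, hx⟩
  · exact totallyBounded_empty
  obtain ⟨D, hD⟩ := Metric.isBounded_iff.1 hb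
  have hD0 : 0 ≤ D := dist_nonneg.trans (hD hx hx)
  refine Metric.totallyBounded_iff.2 fun ε hε => ?_
  -- Large enough that the ball of radius `ε` at `x` lies in each ball of radius `R` at `u n`, and
  -- each small ball at `u n` lies in the ball of radius `R` at `x`.
  set R := D + ε with hR
  have hR0 : 0 < R := by positivity
  obtain ⟨κ, hκ, hκm⟩ := hCD.exists_mul_closedBall_le hN (R := R) (r := ε / 3) hR0 (by positivity)
  have hV0 : κ * m (Metric.closedBall x ε) ≠ 0 :=
    mul_ne_zero hκ (closedBall_pos_of_mem_support (hA hx) hε).ne'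
  by_contra! hcon
  have hsep : ∃ u : ℕ → M, (∀ n, u n ∈ A) ∧ ∀ i j, i < j → ε ≤ dist (u j) (u i) := by
    have hex : ∀ F : Finset M, ∃ y ∈ A, ∀ z ∈ F, ε ≤ dist y z := by
      intro F
      have := hcon F F.finite_toSet
      obtain ⟨y, hy, hyn⟩ := Set.not_subset.1 this
      refine ⟨y, hy, fun z hz => ?_⟩
      by_contra! hlt
      exact hyn (Set.mem_biUnion (Finset.mem_coe.2 hz) hlt)
    classical
    obtain ⟨u, hu⟩ := exists_seq_of_forall_finset_exists (fun y => y ∈ A)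
      (fun z y => ε ≤ dist y z) (fun s _ => by
        obtain ⟨y, hy, h⟩ := hex s
        exact ⟨y, hy, h⟩)
    exact ⟨u, hu.1, fun i j hij => hu.2 i j hij⟩
  obtain ⟨u, huA, hu⟩ := hsep
  have hdisj : Pairwise (Function.onFun Disjoint fun n => Metric.closedBall (u n) (ε / 3)) := by
    intro i j hij
    refine Metric.closedBall_disjoint_closedBall ?_
    rcases hij.lt_or_gt with h | h
    · have := hu i j h; rw [dist_comm] at this; linarith
    · have := hu j i h; linarith
  have hle : ∀ n, κ * m (Metric.closedBall x ε) ≤ m (Metric.closedBall (u n) (ε / 3)) := by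
    intro n
    refine le_trans ?_ (hκm _ (hA (huA n)))
    gcongr
    refine Metric.closedBall_subset_closedBall' ?_
    have := hD hx (huA n)
    linarith
  have hsum : ∑' n, m (Metric.closedBall (u n) (ε / 3)) ≤ m (Metric.closedBall x R) := by
    rw [← measure_iUnion hdisj fun n => Metric.isClosed_closedBall.measurableSet]
    refine measure_mono (Set.iUnion_subset fun n => Metric.closedBall_subset_closedBall' ?_)
    have := hD (huA n) hx
    linarith
  have htop : ∑' _ : ℕ, κ * m (Metric.closedBall x ε) = ∞ := ENNReal.tsum_const_eq_top_of_ne_zero hV0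
  refine hCD.closedBall_ne_top hN (hA hx) R (top_le_iff.1 ?_)
  rw [← htop]
  exact (ENNReal.tsum_le_tsum hle).trans hsum

end Compactness

/-! ### Integrated form of Gromov's lemma -/

section Integration

/-- Approximating `g` from below by simple functions turns estimates with constants on sets into an
inequality of measures. -/
lemma withDensity_le_of_forall_mul_le {X : Type*} [MeasurableSpace X] {μ ν : Measure X} {E : Set X}
    (hE : MeasurableSet E) {g : X → ℝ≥0∞}
    (h : ∀ A ⊆ E, MeasurableSet A → ∀ c, (∀ x ∈ A, c ≤ g x) → c * μ A ≤ ν A) :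
    (μ.restrict E).withDensity g ≤ ν := by
  refine Measure.le_iff.2 fun A hA => ?_
  rw [withDensity_apply _ hA, Measure.restrict_restrict hA, lintegral]
  refine iSup₂_le fun φ hφ => ?_
  calc φ.lintegral (μ.restrict (A ∩ E))
      = ∑ c ∈ φ.range, c * μ (φ ⁻¹' {c} ∩ (A ∩ E)) := by
        refine Finset.sum_congr rfl fun c _ => ?_
        rw [Measure.restrict_apply (φ.measurableSet_fiber c)]
    _ ≤ ∑ c ∈ φ.range, ν (φ ⁻¹' {c} ∩ (A ∩ E)) := by
        refine Finset.sum_le_sum fun c _ => ?_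
        refine h _ (fun x hx => hx.2.2) ((φ.measurableSet_fiber c).inter (hA.inter hE)) c ?_
        rintro x ⟨rfl, -⟩
        exact hφ x
    _ = ∑ c ∈ φ.range, ν.restrict (A ∩ E) (φ ⁻¹' {c}) := by
        refine Finset.sum_congr rfl fun c _ => ?_
        rw [Measure.restrict_apply (φ.measurableSet_fiber c)]
    _ = ν (A ∩ E) := by rw [SimpleFunc.sum_range_measure_preimage_singleton]; simp
    _ ≤ ν A := measure_mono Set.inter_subset_left

/-- Gromov's lemma in integrated form: if `μ` has, in the sense of the hypothesis, a density with
respect to `V` which does not increase, then the quotient of the volumes does not increase. -/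
lemma measure_mul_lintegral_le {μ : Measure ℝ} [SFinite μ] {V : ℝ → ℝ≥0∞} (hV : Measurable V)
    {r R : ℝ} (hr : 0 < r)
    (h : ∀ t ∈ Set.Ioo (0 : ℝ) 1, ∀ φ : ℝ → ℝ≥0∞, Measurable φ →
      ∫⁻ θ in Set.Ioc r R, V (t * θ) * φ θ ∂μ ≤
        ∫⁻ θ in Set.Ioc r R, V θ * φ θ ∂(μ.map (t⁻¹ * ·))) :
    μ (Set.Ioc r R) * ∫⁻ s in Set.Ioc 0 r, V s ≤ μ (Set.Ioc 0 r) * ∫⁻ s in Set.Ioc r R, V s := by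
  -- The factor `θ` is the Jacobian of `s = tθ`; the cut-off restricts to `s ≤ r`.
  set φ : ℝ → ℝ → ℝ≥0∞ := fun t θ => if t * θ ≤ r then ENNReal.ofReal θ else 0 with hφ
  have hφm : ∀ t, Measurable (φ t) := fun t =>
    Measurable.ite (measurableSet_le (by fun_prop) measurable_const) (by fun_prop) measurable_const
  have hφm' : Measurable fun p : ℝ × ℝ => φ p.2 p.1 :=
    Measurable.ite (measurableSet_le (by fun_prop) measurable_const) (by fun_prop) measurable_const
  have step1 : ∀ θ ∈ Set.Ioc r R, ∫⁻ s in Set.Ioc 0 r, V s ≤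
      ∫⁻ t in Set.Ioo (0 : ℝ) 1, V (t * θ) * φ t θ := by
    intro θ hθ
    have hθ0 : 0 < θ := hr.trans hθ.1
    have himg : (fun t => t * θ) '' Set.Ioc 0 (r / θ) = Set.Ioc 0 r := by
      rw [Set.image_mul_right_Ioc _ _ hθ0]
      simp [hθ0.ne']
    rw [← himg, lintegral_image_eq_lintegral_abs_deriv_mul (f' := fun _ => θ) measurableSet_Ioc
      (fun t _ => by simpa using ((hasDerivAt_id t).mul_const θ).hasDerivWithinAt)
      (fun a _ b _ hab => mul_right_cancel₀ hθ0.ne' hab)]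
    have hsub : Set.Ioc 0 (r / θ) ⊆ Set.Ioo (0 : ℝ) 1 := fun t ht =>
      ⟨ht.1, ht.2.trans_lt ((div_lt_one hθ0).2 hθ.1)⟩
    refine le_trans (le_of_eq ?_) (lintegral_mono_set hsub)
    refine setLIntegral_congr_fun measurableSet_Ioc fun t ht => ?_
    have : t * θ ≤ r := (le_div_iff₀ hθ0).1 ht.2
    simp only [hφ, if_pos this, abs_of_pos hθ0]
    rw [mul_comm]
  have step2 : ∀ t ∈ Set.Ioo (0 : ℝ) 1, ∫⁻ θ in Set.Ioc r R, V (t * θ) * φ t θ ∂μ ≤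
      ∫⁻ s in Set.Ioc 0 r, {t : ℝ | t⁻¹ * s ∈ Set.Ioc r R}.indicator
        (fun t => V (t⁻¹ * s) * ENNReal.ofReal (t⁻¹ * s)) t ∂μ := by
    intro t ht
    refine (h t ht _ (hφm t)).trans ?_
    rw [setLIntegral_map measurableSet_Ioc (by fun_prop) (by fun_prop),
      ← lintegral_indicator (by measurability), ← lintegral_indicator measurableSet_Ioc]
    refine lintegral_mono fun s => ?_
    by_cases h1 : t⁻¹ * s ∈ Set.Ioc r R
    · have hs0 : 0 < s := by
        have : 0 < t⁻¹ * s := hr.trans h1.1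
        exact (mul_pos_iff_of_pos_left (inv_pos.2 ht.1)).1 this
      by_cases h2 : s ≤ r
      · rw [Set.indicator_of_mem (by exact h1), Set.indicator_of_mem (by exact ⟨hs0, h2⟩),
          Set.indicator_of_mem (by exact h1)]
        have : t * (t⁻¹ * s) ≤ r := by rwa [mul_inv_cancel_left₀ ht.1.ne']
        simp only [hφ, if_pos this, le_refl]
      · rw [Set.indicator_of_mem (by exact h1)]
        have : ¬ t * (t⁻¹ * s) ≤ r := by rwa [mul_inv_cancel_left₀ ht.1.ne']
        simp only [hφ, if_neg this, mul_zero, zero_le]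
    · rw [Set.indicator_of_notMem (by exact h1)]
      exact zero_le
  have step3 : ∀ s ∈ Set.Ioc 0 r, ∫⁻ t in Set.Ioo (0 : ℝ) 1,
      {t : ℝ | t⁻¹ * s ∈ Set.Ioc r R}.indicator
        (fun t => V (t⁻¹ * s) * ENNReal.ofReal (t⁻¹ * s)) t ≤ ∫⁻ s in Set.Ioc r R, V s := by
    intro s hs
    have hmeas : MeasurableSet {t : ℝ | t⁻¹ * s ∈ Set.Ioc r R} :=
      measurableSet_Ioc.preimage (by fun_prop)
    have himg : {t : ℝ | t⁻¹ * s ∈ Set.Ioc r R} = (fun θ => s * θ⁻¹) '' Set.Ioc r R := by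
      ext t
      constructor
      · intro ht
        refine ⟨t⁻¹ * s, ht, ?_⟩
        simp [hs.1.ne']
      · rintro ⟨θ, hθ, rfl⟩
        have : (s * θ⁻¹)⁻¹ * s = θ := by
          have := hs.1.ne'
          field_simp
        simpa only [Set.mem_ofPred_eq, this] using hθ
    refine (setLIntegral_le_lintegral _ _).trans ?_
    rw [lintegral_indicator hmeas, himg,
      lintegral_image_eq_lintegral_abs_deriv_mul (f' := fun θ => s * (-(θ ^ 2)⁻¹))
        measurableSet_Ioc
        (fun θ hθ => ((hasDerivAt_inv (hr.trans hθ.1).ne').const_mul s).hasDerivWithinAt)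
        (fun a ha b hb hab => inv_injective (mul_left_cancel₀ hs.1.ne' hab))]
    refine setLIntegral_mono hV fun θ hθ => ?_
    have hθ0 : 0 < θ := hr.trans hθ.1
    have h1 : (s * θ⁻¹)⁻¹ * s = θ := by
      have := hs.1.ne'
      field_simp
    -- Substituting `t = s/θ` leaves the weight `s/θ`, at most `1` since `s ≤ r < θ`.
    have h2 : |s * (-(θ ^ 2)⁻¹)| * θ ≤ 1 := by
      rw [mul_neg, abs_neg, abs_of_pos (mul_pos hs.1 (by positivity))]
      have : s * (θ ^ 2)⁻¹ * θ = s / θ := by field_simp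
      rw [this, div_le_one hθ0]
      exact hs.2.trans hθ.1.le
    rw [h1, mul_left_comm, ← ENNReal.ofReal_mul (abs_nonneg _)]
    exact mul_le_of_le_one_right' (ENNReal.ofReal_le_one.2 h2)
  calc μ (Set.Ioc r R) * ∫⁻ s in Set.Ioc 0 r, V s
      = ∫⁻ _ in Set.Ioc r R, (∫⁻ s in Set.Ioc 0 r, V s) ∂μ := by
        rw [lintegral_const, Measure.restrict_apply_univ, mul_comm]
    _ ≤ ∫⁻ θ in Set.Ioc r R, (∫⁻ t in Set.Ioo (0 : ℝ) 1, V (t * θ) * φ t θ) ∂μ :=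
        setLIntegral_mono' measurableSet_Ioc step1
    _ = ∫⁻ t in Set.Ioo (0 : ℝ) 1, ∫⁻ θ in Set.Ioc r R, V (t * θ) * φ t θ ∂μ := by
        refine lintegral_lintegral_swap (Measurable.aemeasurable ?_)
        exact (hV.comp (by fun_prop)).mul hφm'
    _ ≤ ∫⁻ t in Set.Ioo (0 : ℝ) 1, ∫⁻ s in Set.Ioc 0 r,
          {t : ℝ | t⁻¹ * s ∈ Set.Ioc r R}.indicator
            (fun t => V (t⁻¹ * s) * ENNReal.ofReal (t⁻¹ * s)) t ∂μ :=
        setLIntegral_mono' measurableSet_Ioo step2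
    _ = ∫⁻ s in Set.Ioc 0 r, (∫⁻ t in Set.Ioo (0 : ℝ) 1,
          {t : ℝ | t⁻¹ * s ∈ Set.Ioc r R}.indicator
            (fun t => V (t⁻¹ * s) * ENNReal.ofReal (t⁻¹ * s)) t) ∂μ := by
        refine lintegral_lintegral_swap (Measurable.aemeasurable ?_)
        have hm : MeasurableSet {p : ℝ × ℝ | p.1⁻¹ * p.2 ∈ Set.Ioc r R} :=
          measurableSet_Ioc.preimage (by fun_prop)
        have hf : Measurable fun p : ℝ × ℝ => V (p.1⁻¹ * p.2) * ENNReal.ofReal (p.1⁻¹ * p.2) := by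
          fun_prop
        exact hf.indicator hm
    _ ≤ ∫⁻ _ in Set.Ioc 0 r, (∫⁻ s in Set.Ioc r R, V s) ∂μ :=
        setLIntegral_mono' measurableSet_Ioc step3
    _ = _ := by rw [lintegral_const, Measure.restrict_apply_univ, mul_comm]

end Integration

/-! ### Comparison of the radial measure with a model function -/

/-- `w` is a continuous function whose quotients bound the distortion coefficients from below. -/
structure IsComparison (K N : ℝ) (w : ℝ → ℝ) : Prop where
  continuous : Continuous w
  nonneg : ∀ θ, 0 ≤ θ → 0 ≤ w θ
  zero_of_le : ∀ R, 0 < R → w R = 0 → ∀ θ, R ≤ θ → w θ = 0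
  le_sigma : ∀ t ∈ Set.Ioo (0 : ℝ) 1, ∀ θ, 0 < θ →
    ENNReal.ofReal (w (t * θ)) / ENNReal.ofReal (w θ) ≤ sigma K N t θ

section Comparison

variable {w : ℝ → ℝ}

/-- In `ℝ≥0∞` the quotient can be discontinuous only where its numerator vanishes; there it is `0`,
so such points do not lie in the set. -/
lemma isOpen_lt_div (hw : Continuous w) (t : ℝ) (c : ℝ≥0∞) :
    IsOpen {θ | c < ENNReal.ofReal (w (t * θ)) / ENNReal.ofReal (w θ)} := by
  refine isOpen_iff_mem_nhds.2 fun θ hθ => ?_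
  have hne : ENNReal.ofReal (w (t * θ)) ≠ 0 := by
    intro h0
    simp [h0] at hθ
  have h1 : Filter.Tendsto (fun θ => ENNReal.ofReal (w (t * θ)) / ENNReal.ofReal (w θ)) (𝓝 θ)
      (𝓝 (ENNReal.ofReal (w (t * θ)) / ENNReal.ofReal (w θ))) :=
    ENNReal.Tendsto.div
      ((ENNReal.continuous_ofReal.comp (hw.comp (by fun_prop : Continuous (t * ·)))).tendsto θ)
      (Or.inl hne) ((ENNReal.continuous_ofReal.comp hw).tendsto θ)
      (Or.inl ENNReal.ofReal_ne_top)
  exact h1.eventually (lt_mem_nhds hθ)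

variable {M : Type*} [MetricSpace M] [MeasurableSpace M] [BorelSpace M] [CompleteSpace M]
  [TopologicalSpace.SeparableSpace M] {m : Measure M} [IsLocallyFiniteMeasure m] {K N : ℝ}
  {x₀ : M}

lemma CDStar.map_dist_ne_top (hCD : CDStar K N m) (hN : 1 ≤ N) (hx₀ : x₀ ∈ m.support) {E : Set ℝ}
    (hE : Bornology.IsBounded E) : m.map (dist · x₀) E ≠ ∞ := by
  obtain ⟨R, hR⟩ := hE.subset_closedBall 0
  refine ne_top_of_le_ne_top ?_ (measure_mono hR)
  rw [Measure.map_apply (by fun_prop) Metric.isClosed_closedBall.measurableSet]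
  refine ne_top_of_le_ne_top (hCD.closedBall_ne_top hN hx₀ R) (measure_mono fun y hy => ?_)
  simpa [Real.norm_of_nonneg] using hy

lemma CDStar.rpow_mul_map_le_of_isCompact (hCD : CDStar K N m) (hN : 1 ≤ N)
    (hx₀ : x₀ ∈ m.support) (hw : IsComparison K N w) {t : ℝ} (ht : t ∈ Set.Ioo (0 : ℝ) 1)
    {C : Set ℝ} (hC : IsCompact C) (hC0 : C ⊆ Set.Ioi 0) {c : ℝ≥0∞}
    (hc : ∀ θ ∈ C, c ≤ ENNReal.ofReal (w (t * θ)) / ENNReal.ofReal (w θ)) :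
    c ^ N * m.map (dist · x₀) C ≤ m.map (dist · x₀) ((t * ·) '' C) := by
  have hN0 : 0 < N := by linarith
  set μ := m.map (dist · x₀) with hμ
  rcases eq_or_ne (μ C) 0 with h0 | h0
  · simp [h0]
  have htop : μ C ≠ ∞ := hCD.map_dist_ne_top hN hx₀ hC.isBounded
  have hC' : IsCompact ((t * ·) '' C) := hC.image (by fun_prop)
  -- The strict inequality leaves room to thicken `C`. As `ε → 0` the thickenings of the compact
  -- image shrink to it, and finiteness of `μ` on bounded sets gives convergence of the masses.
  have key : ∀ c' < c, c' ^ N * μ C ≤ μ ((t * ·) '' C) := by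
    intro c' hc'
    obtain ⟨δ, hδ, hsub⟩ := hC.exists_cthickening_subset_open
      ((isOpen_lt_div hw.continuous t c').inter isOpen_Ioi)
      fun θ hθ => ⟨hc'.trans_le (hc θ hθ), hC0 hθ⟩
    have hlim : Filter.Tendsto (fun ε => μ (Metric.cthickening (3 * ε) ((t * ·) '' C)))
        (𝓝[>] 0) (𝓝 (μ ((t * ·) '' C))) := by
      have h1 := tendsto_measure_cthickening_of_isClosed (μ := μ) (s := (t * ·) '' C)
        ⟨1, one_pos, hCD.map_dist_ne_top hN hx₀ hC'.isBounded.cthickening⟩ hC'.isClosed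
      refine h1.comp ?_
      have h2 : Filter.Tendsto (fun ε : ℝ => 3 * ε) (𝓝 0) (𝓝 (3 * 0)) :=
        (continuous_const_mul 3).tendsto 0
      rw [mul_zero] at h2
      exact h2.mono_left nhdsWithin_le_nhds
    refine ge_of_tendsto hlim ?_
    filter_upwards [Ioc_mem_nhdsGT hδ] with ε hε
    rw [hμ, Measure.map_apply (by fun_prop) hC.isClosed.measurableSet,
      Measure.map_apply (by fun_prop) Metric.isClosed_cthickening.measurableSet]
    have hm : MeasurableSet ((dist · x₀) ⁻¹' C) :=
      hC.isClosed.measurableSet.preimage (by fun_prop)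
    refine hCD.rpow_mul_measure_le hN hx₀ ht hε.1 (C := C) ?_ hm ?_ ?_ (fun a ha => ha)
    · intro θ hθ _
      have := hsub (Metric.cthickening_mono hε.2 _ hθ)
      exact this.1.le.trans (hw.le_sigma t ht θ this.2)
    · obtain ⟨R, hR⟩ := hC.isBounded.subset_closedBall 0
      refine (Metric.isBounded_closedBall (x := x₀) (r := R)).subset fun y hy => ?_
      simpa [Real.norm_of_nonneg] using hR hy
    · rwa [hμ, Measure.map_apply (by fun_prop) hC.isClosed.measurableSet] at htop
  rw [← ENNReal.le_div_iff_mul_le (Or.inl h0) (Or.inl htop), ← ENNReal.le_rpow_inv_iff hN0]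
  refine le_of_forall_lt_imp_le_of_dense fun c' hc' => ?_
  rw [ENNReal.le_rpow_inv_iff hN0, ENNReal.le_div_iff_mul_le (Or.inl h0) (Or.inl htop)]
  exact key c' hc'

lemma map_inv_mul_apply (μ : Measure ℝ) {t : ℝ} (ht : 0 < t) {E : Set ℝ} (hE : MeasurableSet E) :
    μ.map (t⁻¹ * ·) E = μ ((t * ·) '' E) := by
  rw [Measure.map_apply (by fun_prop) hE]
  congr 1
  exact ((Equiv.mulLeft₀ t ht.ne').image_eq_preimage_symm E).symm

lemma CDStar.rpow_mul_map_le (hCD : CDStar K N m) (hN : 1 ≤ N)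
    (hx₀ : x₀ ∈ m.support) (hw : IsComparison K N w) {t : ℝ} (ht : t ∈ Set.Ioo (0 : ℝ) 1)
    {E : Set ℝ} (hE : MeasurableSet E) (hb : Bornology.IsBounded E) (hE0 : E ⊆ Set.Ioi 0)
    {c : ℝ≥0∞} (hc : ∀ θ ∈ E, c ≤ ENNReal.ofReal (w (t * θ)) / ENNReal.ofReal (w θ)) :
    c ^ N * m.map (dist · x₀) E ≤ (m.map (dist · x₀)).map (t⁻¹ * ·) E := by
  rw [hE.measure_eq_iSup_isCompact_of_ne_top (hCD.map_dist_ne_top hN hx₀ hb)]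
  simp only [ENNReal.mul_iSup]
  refine iSup₂_le fun C hCE => iSup_le fun hC => ?_
  rw [map_inv_mul_apply _ ht.1 hE]
  exact (hCD.rpow_mul_map_le_of_isCompact hN hx₀ hw ht hC (hCE.trans hE0)
    fun θ hθ => hc θ (hCE hθ)).trans (measure_mono (Set.image_mono hCE))

lemma CDStar.map_inv_mul_ne_top (hCD : CDStar K N m) (hN : 1 ≤ N)
    (hx₀ : x₀ ∈ m.support) {t : ℝ} (ht : 0 < t) {E : Set ℝ} (hE : MeasurableSet E)
    (hb : Bornology.IsBounded E) : (m.map (dist · x₀)).map (t⁻¹ * ·) E ≠ ∞ := by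
  rw [map_inv_mul_apply _ ht hE]
  refine hCD.map_dist_ne_top hN hx₀ ?_
  exact hb.image (ContinuousLinearMap.mul ℝ ℝ t)

/-- Here the quotient is a positive number over `0`, so `c = ∞` is admissible, while the contracted
set has finite mass. -/
lemma CDStar.map_eq_zero (hCD : CDStar K N m) (hN : 1 ≤ N)
    (hx₀ : x₀ ∈ m.support) (hw : IsComparison K N w) {t : ℝ} (ht : t ∈ Set.Ioo (0 : ℝ) 1)
    {E : Set ℝ} (hE : MeasurableSet E) (hb : Bornology.IsBounded E) (hE0 : E ⊆ Set.Ioi 0)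
    (h0 : ∀ θ ∈ E, w θ = 0) (h1 : ∀ θ ∈ E, w (t * θ) ≠ 0) : m.map (dist · x₀) E = 0 := by
  have h2 := hCD.rpow_mul_map_le hN hx₀ hw ht hE hb hE0 (c := ∞) fun θ hθ => by
    rw [h0 θ hθ, ENNReal.ofReal_zero, ENNReal.div_zero]
    have := (hw.nonneg _ (mul_pos ht.1 (hE0 hθ)).le).lt_of_ne (h1 θ hθ).symm
    simpa using this
  by_contra hne
  rw [ENNReal.top_rpow_of_pos (by linarith), ENNReal.top_mul hne, top_le_iff] at h2
  exact hCD.map_inv_mul_ne_top hN hx₀ ht.1 hE hb h2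

lemma CDStar.lintegral_comparison (hCD : CDStar K N m) (hN : 1 ≤ N)
    (hx₀ : x₀ ∈ m.support) (hw : IsComparison K N w) {t : ℝ} (ht : t ∈ Set.Ioo (0 : ℝ) 1)
    {E : Set ℝ} (hE : MeasurableSet E) (hb : Bornology.IsBounded E) (hE0 : E ⊆ Set.Ioi 0)
    {φ : ℝ → ℝ≥0∞} (hφ : Measurable φ) :
    ∫⁻ θ in E, ENNReal.ofReal (w (t * θ)) ^ N * φ θ ∂(m.map (dist · x₀)) ≤
      ∫⁻ θ in E, ENNReal.ofReal (w θ) ^ N * φ θ ∂((m.map (dist · x₀)).map (t⁻¹ * ·)) := by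
  have hN0 : 0 < N := by linarith
  set μ := m.map (dist · x₀) with hμ
  set ν := μ.map (t⁻¹ * ·) with hν
  have hwm := hw.continuous.measurable
  set g : ℝ → ℝ≥0∞ := fun θ => (ENNReal.ofReal (w (t * θ)) / ENNReal.ofReal (w θ)) ^ N with hg
  have hgm : Measurable g := by fun_prop
  have hle : (μ.restrict E).withDensity g ≤ ν.restrict E := by
    refine withDensity_le_of_forall_mul_le hE fun A hAE hA c hc => ?_
    rw [Measure.restrict_apply hA, Set.inter_eq_left.2 hAE]
    have := hCD.rpow_mul_map_le hN hx₀ hw ht hA (hb.subset hAE) (hAE.trans hE0) (c := c ^ N⁻¹)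
      fun θ hθ => by
        rw [ENNReal.rpow_inv_le_iff hN0]
        exact hc θ hθ
    rwa [← ENNReal.rpow_mul, inv_mul_cancel₀ hN0.ne', ENNReal.rpow_one] at this
  -- Multiplying the quotient by its denominator fails only on this set.
  have hnull : μ (E ∩ {θ | w θ = 0 ∧ w (t * θ) ≠ 0}) = 0 := by
    refine hCD.map_eq_zero hN hx₀ hw ht (hE.inter ?_) (hb.subset Set.inter_subset_left)
      (Set.inter_subset_left.trans hE0) (fun θ hθ => hθ.2.1) (fun θ hθ => hθ.2.2)
    exact (hwm (measurableSet_singleton 0)).inter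
      ((hwm.comp (measurable_const_mul t)) (measurableSet_singleton 0).compl)
  calc ∫⁻ θ in E, ENNReal.ofReal (w (t * θ)) ^ N * φ θ ∂μ
      = ∫⁻ θ in E, g θ * (ENNReal.ofReal (w θ) ^ N * φ θ) ∂μ := by
        refine setLIntegral_congr_fun_ae hE ?_
        filter_upwards [measure_eq_zero_iff_ae_notMem.1 hnull] with θ hθ hθE
        rw [← mul_assoc]
        congr 1
        simp only [hg]
        rw [← ENNReal.mul_rpow_of_nonneg _ _ hN0.le]
        congr 1
        rcases (hw.nonneg θ (hE0 hθE).le).eq_or_lt with h0 | h0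
        · have : w (t * θ) = 0 := by
            by_contra hne
            exact hθ ⟨hθE, h0.symm, hne⟩
          simp [this]
        · rw [ENNReal.div_mul_cancel (by simpa using h0) ENNReal.ofReal_ne_top]
    _ = ∫⁻ θ, ENNReal.ofReal (w θ) ^ N * φ θ ∂((μ.restrict E).withDensity g) :=
        (lintegral_withDensity_eq_lintegral_mul _ hgm (by fun_prop)).symm
    _ ≤ ∫⁻ θ in E, ENNReal.ofReal (w θ) ^ N * φ θ ∂ν := lintegral_mono' hle le_rfl

/-- The comparison of the volumes of balls, with denominators cleared. -/
lemma CDStar.ballVolume_mul_le (hCD : CDStar K N m) (hN : 1 ≤ N)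
    (hx₀ : x₀ ∈ m.support) (hw : IsComparison K N w) {r R : ℝ} (hr : 0 < r) (hrR : r < R) :
    ballVolume m x₀ R * ∫⁻ s in Set.Ioc 0 r, ENNReal.ofReal (w s) ^ N ≤
      ballVolume m x₀ r * ∫⁻ s in Set.Ioc 0 R, ENNReal.ofReal (w s) ^ N := by
  have : SecondCountableTopology M := UniformSpace.secondCountable_of_separable M
  set μ := m.map (dist · x₀) with hμ
  set V : ℝ → ℝ≥0∞ := fun s => ENNReal.ofReal (w s) ^ N with hV
  have hwm := hw.continuous.measurable
  have h1 := measure_mul_lintegral_le (μ := μ) (V := V) (by fun_prop) (R := R) hr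
    fun t ht φ hφ => hCD.lintegral_comparison hN hx₀ hw ht measurableSet_Ioc
      (Metric.isBounded_Ioc _ _) (fun θ hθ => hr.trans hθ.1) hφ
  have h2 : ballVolume m x₀ R = ballVolume m x₀ r + μ (Set.Ioc r R) := by
    rw [hμ, Measure.map_apply (by fun_prop) measurableSet_Ioc, ballVolume, ballVolume,
      ← measure_union _ (measurableSet_Ioc.preimage (by fun_prop))]
    · congr 1
      ext y
      simp only [Metric.mem_closedBall, Set.mem_union, Set.mem_preimage, Set.mem_Ioc]
      grind
    · refine Set.disjoint_left.2 fun y hy hy' => ?_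
      exact hy'.1.not_ge hy
  have h3 : μ (Set.Ioc 0 r) ≤ ballVolume m x₀ r := by
    rw [hμ, Measure.map_apply (by fun_prop) measurableSet_Ioc]
    exact measure_mono fun y hy => hy.2
  have h4 : ∫⁻ s in Set.Ioc 0 R, V s =
      (∫⁻ s in Set.Ioc 0 r, V s) + ∫⁻ s in Set.Ioc r R, V s := by
    rw [← Set.Ioc_union_Ioc_eq_Ioc hr.le hrR.le,
      lintegral_union measurableSet_Ioc (Set.Ioc_disjoint_Ioc_of_le le_rfl)]
  -- Both sides share the term `v(r) ∫₀ʳ`; what remains is the comparison of the annulus with the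
  -- inner ball.
  rw [h2, h4, add_mul, mul_add]
  exact add_le_add_right (h1.trans (by gcongr)) _

/-- The comparison of the volumes of spheres. -/
lemma CDStar.sphereVolume_mul_le (hCD : CDStar K N m) (hN : 1 ≤ N)
    (hx₀ : x₀ ∈ m.support) (hw : IsComparison K N w) {r R : ℝ} (hr : 0 < r) (hrR : r < R) :
    ENNReal.ofReal (w r) ^ N * sphereVolume m x₀ R ≤
      ENNReal.ofReal (w R) ^ N * sphereVolume m x₀ r := by
  have hN0 : 0 < N := by linarith
  have hR : 0 < R := hr.trans hrR
  set μ := m.map (dist · x₀) with hμ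
  have hsphere : ∀ ρ : ℝ, sphereVolume m x₀ ρ =
      Filter.limsup (fun δ : ℝ => μ (Set.Icc ρ (ρ + δ)) / ENNReal.ofReal δ) (𝓝[>] 0) := by
    intro ρ
    rw [sphereVolume]
    congr 1
    ext δ
    rw [hμ, Measure.map_apply (by fun_prop) measurableSet_Icc]
    congr 2
    ext y
    simp [and_comm]
  set t := r / R with ht
  have htI : t ∈ Set.Ioo (0 : ℝ) 1 := ⟨by positivity, (div_lt_one hR).2 hrR⟩
  have htR : t * R = r := div_mul_cancel₀ r hR.ne'
  have hnear : ∀ U : Set ℝ, IsOpen U → R ∈ U → ∀ᶠ δ in 𝓝[>] (0 : ℝ), Set.Icc R (R + δ) ⊆ U := by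
    intro U hU hRU
    obtain ⟨η, hη, hsub⟩ := Metric.isOpen_iff.1 hU R hRU
    filter_upwards [Ioo_mem_nhdsGT hη] with δ hδ θ hθ
    refine hsub ?_
    rw [Metric.mem_ball, Real.dist_eq, abs_of_nonneg (by linarith [hθ.1])]
    linarith [hθ.2, hδ.2]
  have hpos : ∀ δ, Set.Icc R (R + δ) ⊆ Set.Ioi 0 := fun δ θ hθ => hR.trans_le hθ.1
  rcases (hw.nonneg r hr.le).eq_or_lt with hwr | hwr
  · simp [← hwr, hN0]
  rcases (hw.nonneg R hR.le).eq_or_lt with hwR | hwR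
  -- Beyond `R` the function `w` vanishes, while `w(tθ)` stays positive for `θ` near `R`; thin
  -- shells outside `R` are therefore null.
  · have hzero : sphereVolume m x₀ R = 0 := by
      rw [hsphere]
      refine (Filter.limsup_congr ?_).trans (Filter.limsup_const (0 : ℝ≥0∞))
      have hopen : IsOpen {θ | 0 < w (t * θ)} :=
        isOpen_lt continuous_const (hw.continuous.comp (by fun_prop))
      filter_upwards [hnear _ hopen (by simpa [htR] using hwr)] with δ hδ
      rw [hμ, hCD.map_eq_zero hN hx₀ hw htI measurableSet_Icc (Metric.isBounded_Icc _ _) (hpos δ)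
        (fun θ hθ => hw.zero_of_le R hR hwR.symm θ hθ.1) (fun θ hθ => (hδ hθ).ne'),
        ENNReal.zero_div]
    simp [hzero]
  set q := ENNReal.ofReal (w r) / ENNReal.ofReal (w R) with hq
  have hq0 : q ≠ 0 := ENNReal.div_ne_zero.2 ⟨by simpa using hwr, ENNReal.ofReal_ne_top⟩
  -- Scaling by `t = r/R` sends `[R, R+δ]` to `[r, r+tδ]`. Dividing by `tδ ≤ δ` only enlarges the
  -- bound, and sampling the limsup along `tδ` cannot increase it.
  have key : ∀ c < q, c ^ N * sphereVolume m x₀ R ≤ sphereVolume m x₀ r := by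
    intro c hc
    have hcomp : Filter.limsup
        ((fun δ : ℝ => μ (Set.Icc r (r + δ)) / ENNReal.ofReal δ) ∘ (t * ·)) (𝓝[>] 0) ≤
        sphereVolume m x₀ r := by
      rw [hsphere, Filter.limsup_comp]
      refine Filter.limsup_le_limsup_of_le ?_
      refine tendsto_nhdsWithin_iff.2 ⟨?_, ?_⟩
      · have h2 : Filter.Tendsto (fun ε : ℝ => t * ε) (𝓝 0) (𝓝 (t * 0)) :=
          (continuous_const_mul t).tendsto 0
        rw [mul_zero] at h2
        exact h2.mono_left nhdsWithin_le_nhds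
      · filter_upwards [self_mem_nhdsWithin] with δ hδ using mul_pos htI.1 hδ
    refine le_trans ?_ hcomp
    rw [hsphere, ← ENNReal.limsup_const_mul_of_ne_top
      (ENNReal.rpow_ne_top_of_nonneg hN0.le hc.ne_top)]
    refine Filter.limsup_le_limsup ?_
    filter_upwards [self_mem_nhdsWithin,
      hnear _ (isOpen_lt_div hw.continuous t c) (by simpa [htR] using hc)] with δ hδ hsub
    have hδ0 : (0 : ℝ) < δ := hδ
    have h1 := hCD.rpow_mul_map_le hN hx₀ hw htI measurableSet_Icc (Metric.isBounded_Icc _ _) (hpos δ)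
      (c := c) fun θ hθ => (hsub hθ).le
    rw [map_inv_mul_apply _ htI.1 measurableSet_Icc, Set.image_mul_left_Icc' htI.1, mul_add,
      htR] at h1
    rw [Function.comp, ← mul_div_assoc]
    refine ENNReal.div_le_div h1 (ENNReal.ofReal_le_ofReal ?_)
    nlinarith [htI.2]
  have hlim : q ^ N * sphereVolume m x₀ R ≤ sphereVolume m x₀ r := by
    have hbot : (𝓝[<] q).NeBot := nhdsLT_neBot_of_exists_lt ⟨0, pos_iff_ne_zero.2 hq0⟩
    have h1 : Filter.Tendsto (fun c : ℝ≥0∞ => c ^ N * sphereVolume m x₀ R) (𝓝[<] q)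
        (𝓝 (q ^ N * sphereVolume m x₀ R)) := by
      refine ENNReal.Tendsto.mul_const ?_ (Or.inl ?_)
      · exact (ENNReal.continuous_rpow_const.tendsto q).mono_left nhdsWithin_le_nhds
      · simp [ENNReal.rpow_eq_zero_iff, hq0, hN0.not_gt]
    refine le_of_tendsto h1 ?_
    filter_upwards [self_mem_nhdsWithin] with c hc using key c hc
  calc ENNReal.ofReal (w r) ^ N * sphereVolume m x₀ R
      = ENNReal.ofReal (w R) ^ N * (q ^ N * sphereVolume m x₀ R) := by
        rw [← mul_assoc, ← ENNReal.mul_rpow_of_nonneg _ _ hN0.le, hq,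
          ENNReal.mul_div_cancel (by simpa using hwR) ENNReal.ofReal_ne_top]
    _ ≤ _ := by gcongr

lemma CDStar.ofReal_div_le_ballVolume_div (hCD : CDStar K N m) (hN : 1 ≤ N)
    (hx₀ : x₀ ∈ m.support) (hw : IsComparison K N w) {r R : ℝ} (hr : 0 < r) (hrR : r < R) :
    ENNReal.ofReal ((∫ s in (0 : ℝ)..r, w s ^ N) / (∫ s in (0 : ℝ)..R, w s ^ N)) ≤
      ballVolume m x₀ r / ballVolume m x₀ R := by
  have hN0 : 0 < N := by linarith
  have hR : 0 < R := hr.trans hrR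
  have hcont : Continuous fun s => w s ^ N := hw.continuous.rpow_const fun _ => Or.inr hN0.le
  have hnn : ∀ s, 0 ≤ s → 0 ≤ w s ^ N := fun s hs => Real.rpow_nonneg (hw.nonneg s hs) _
  have hint : ∀ ρ, 0 < ρ → ENNReal.ofReal (∫ s in (0 : ℝ)..ρ, w s ^ N) =
      ∫⁻ s in Set.Ioc 0 ρ, ENNReal.ofReal (w s) ^ N := by
    intro ρ hρ
    rw [intervalIntegral.integral_of_le hρ.le, ofReal_integral_eq_lintegral_ofReal
      ((hcont.integrableOn_Icc).mono_set Set.Ioc_subset_Icc_self)]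
    · refine setLIntegral_congr_fun measurableSet_Ioc fun s hs => ?_
      exact (ENNReal.ofReal_rpow_of_nonneg (hw.nonneg s hs.1.le) hN0.le).symm
    · exact (ae_restrict_mem measurableSet_Ioc).mono fun s hs => hnn s hs.1.le
  have hRnn : 0 ≤ ∫ s in (0 : ℝ)..R, w s ^ N :=
    intervalIntegral.integral_nonneg hR.le fun s hs => hnn s hs.1
  -- If the denominator vanishes, the real quotient is `0` by convention.
  rcases hRnn.eq_or_lt with h0 | h0
  · simp [← h0]
  have hv0 : ballVolume m x₀ R ≠ 0 := (closedBall_pos_of_mem_support hx₀ hR).ne'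
  have hvtop : ballVolume m x₀ R ≠ ∞ := hCD.closedBall_ne_top hN hx₀ R
  have h := hCD.ballVolume_mul_le hN hx₀ hw hr hrR
  rw [← hint r hr, ← hint R hR] at h
  rw [ENNReal.ofReal_div_of_pos h0]
  refine ENNReal.div_le_of_le_mul ?_
  rw [← ENNReal.mul_div_right_comm, ENNReal.le_div_iff_mul_le (Or.inl hv0) (Or.inl hvtop), mul_comm]
  exact h

end Comparison

/-! ### The two model functions -/

section ModelFunctions

/-- Truncating the argument at `π` makes `w` vanish exactly where `sigma` becomes infinite, so that
the bound holds for all `θ > 0`. -/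
lemma isComparison_sin {K N : ℝ} (hK : 0 < K) (hN : 0 < N) :
    IsComparison K N fun θ => Real.sin (min (√(K / N) * θ) Real.pi) := by
  have ha : 0 < √(K / N) := Real.sqrt_pos.2 (by positivity)
  refine ⟨by fun_prop, fun θ hθ => ?_, fun R hR h θ hθ => ?_, fun t ht θ hθ => ?_⟩
  · exact Real.sin_nonneg_of_nonneg_of_le_pi (le_min (by positivity) Real.pi_pos.le)
      (min_le_right _ _)
  · have hR' : Real.pi ≤ √(K / N) * R := by
      by_contra! hlt
      rw [min_eq_left hlt.le] at h
      exact (Real.sin_pos_of_pos_of_lt_pi (by positivity) hlt).ne' h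
    rw [min_eq_right (hR'.trans (by gcongr)), Real.sin_pi]
  · rcases le_or_gt Real.pi (√(K / N) * θ) with h | h
    · rw [sigma_of_pi_le hK hN hθ h]
      exact le_top
    · have hs : 0 < Real.sin (√(K / N) * θ) := Real.sin_pos_of_pos_of_lt_pi (by positivity) h
      have h' : √(K / N) * (t * θ) ≤ √(K / N) * θ := by
        gcongr
        exact mul_le_of_le_one_left hθ.le ht.2.le
      rw [sigma_of_lt_pi hK hN ht.1 hθ h, min_eq_left h.le, min_eq_left (h'.trans h.le),
        ENNReal.ofReal_div_of_pos hs]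

lemma isComparison_sinh {K N : ℝ} (hK : K < 0) (hN : 0 < N) :
    IsComparison K N fun θ => Real.sinh (√(-K / N) * θ) := by
  have ha : 0 < √(-K / N) := Real.sqrt_pos.2 (div_pos (by linarith) hN)
  refine ⟨by fun_prop, fun θ hθ => ?_, fun R hR h θ hθ => ?_, fun t ht θ hθ => ?_⟩
  · exact Real.sinh_nonneg_iff.2 (by positivity)
  · exact absurd h (Real.sinh_pos_iff.2 (by positivity)).ne'
  · rw [sigma_of_neg hK hN ht.1 hθ,
      ENNReal.ofReal_div_of_pos (Real.sinh_pos_iff.2 (by positivity))]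

end ModelFunctions

end ReducedCD

theorem theorem6p2 {M : Type*} [MetricSpace M] [CompleteSpace M]
    [TopologicalSpace.SeparableSpace M] [MeasurableSpace M] [BorelSpace M]
    (m : MeasureTheory.Measure M) [MeasureTheory.IsLocallyFiniteMeasure m]
    (K N : ℝ) (hN : 1 ≤ N) (hCD : ReducedCD.CDStar K N m) :
    (∀ A : Set M, A ⊆ m.support → Bornology.IsBounded A → IsClosed A →
      IsCompact A ∧ m A < ∞) ∧
    (0 < K → ∀ x₀ ∈ m.support, ∀ r R : ℝ, 0 < r → r < R → R ≤ Real.pi * √(N / K) →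
      ENNReal.ofReal (Real.sin (r * √(K / N)) ^ N) * ReducedCD.sphereVolume m x₀ R ≤
        ENNReal.ofReal (Real.sin (R * √(K / N)) ^ N) * ReducedCD.sphereVolume m x₀ r ∧
      ENNReal.ofReal ((∫ t in (0 : ℝ)..r, Real.sin (t * √(K / N)) ^ N) /
          (∫ t in (0 : ℝ)..R, Real.sin (t * √(K / N)) ^ N)) ≤
        ReducedCD.ballVolume m x₀ r / ReducedCD.ballVolume m x₀ R) ∧
    (K < 0 → ∀ x₀ ∈ m.support, ∀ r R : ℝ, 0 < r → r < R →
      ENNReal.ofReal (Real.sinh (r * √(-K / N)) ^ N) * ReducedCD.sphereVolume m x₀ R ≤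
        ENNReal.ofReal (Real.sinh (R * √(-K / N)) ^ N) * ReducedCD.sphereVolume m x₀ r ∧
      ENNReal.ofReal ((∫ t in (0 : ℝ)..r, Real.sinh (t * √(-K / N)) ^ N) /
          (∫ t in (0 : ℝ)..R, Real.sinh (t * √(-K / N)) ^ N)) ≤
        ReducedCD.ballVolume m x₀ r / ReducedCD.ballVolume m x₀ R) := by
  have hN0 : 0 < N := by linarith
  refine ⟨fun A hA hb hc => ⟨?_, hCD.measure_lt_top hN hA hb⟩, fun hK x₀ hx₀ r R hr hrR hR => ?_,
    fun hK x₀ hx₀ r R hr hrR => ?_⟩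
  · exact TotallyBounded.isCompact_of_isClosed (hCD.totallyBounded hN hA hb) hc
  · have hw := ReducedCD.isComparison_sin hK hN0
    -- The truncation at `π` is inactive on `[0, R]`.
    have hR' : √(K / N) * R ≤ Real.pi := by
      calc √(K / N) * R ≤ √(K / N) * (Real.pi * √(N / K)) := by gcongr
        _ = Real.pi := by
          rw [← inv_div K N, Real.sqrt_inv]
          have : √(K / N) ≠ 0 := (Real.sqrt_pos.2 (by positivity)).ne'
          field_simp
    have hmin : ∀ s ≤ R, Real.sin (min (√(K / N) * s) Real.pi) = Real.sin (s * √(K / N)) := by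
      intro s hs
      rw [min_eq_left ((mul_le_mul_of_nonneg_left hs (Real.sqrt_nonneg _)).trans hR'), mul_comm]
    have hnn : ∀ s, 0 ≤ s → s ≤ R → 0 ≤ Real.sin (s * √(K / N)) := fun s h0 hs => by
      rw [← hmin s hs]
      exact hw.nonneg s h0
    have hint : ∀ ρ, 0 < ρ → ρ ≤ R → ∫ s in (0 : ℝ)..ρ, Real.sin (s * √(K / N)) ^ N =
        ∫ s in (0 : ℝ)..ρ, Real.sin (min (√(K / N) * s) Real.pi) ^ N := by
      intro ρ h0 hρ
      refine intervalIntegral.integral_congr fun s hs => ?_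
      rw [Set.uIcc_of_le h0.le] at hs
      simp only [hmin s (hs.2.trans hρ)]
    constructor
    · have h := hCD.sphereVolume_mul_le hN hx₀ hw hr hrR
      simp only [hmin r hrR.le, hmin R le_rfl] at h
      rwa [ENNReal.ofReal_rpow_of_nonneg (hnn r hr.le hrR.le) hN0.le,
        ENNReal.ofReal_rpow_of_nonneg (hnn R (hr.trans hrR).le le_rfl) hN0.le] at h
    · rw [hint r hr hrR.le, hint R (hr.trans hrR) le_rfl]
      exact hCD.ofReal_div_le_ballVolume_div hN hx₀ hw hr hrR
  · have hw := ReducedCD.isComparison_sinh hK hN0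
    have hnn := hw.nonneg
    simp only [mul_comm (√(-K / N))] at hw hnn
    constructor
    · have h := hCD.sphereVolume_mul_le hN hx₀ hw hr hrR
      rwa [ENNReal.ofReal_rpow_of_nonneg (hnn r hr.le) hN0.le,
        ENNReal.ofReal_rpow_of_nonneg (hnn R (hr.trans hrR).le) hN0.le] at h
    · exact hCD.ofReal_div_le_ballVolume_div hN hx₀ hw hr hrR
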